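/- Let $\mathfrak{osp}(1|2)$ be the complex Lie superalgebra with even basis vectors $x_{-2\alpha},h,x_{2\alpha}$, odd basis vectors $x_{-\alpha},x_{\alpha}$, and super brackets $$[h,x_{\pm k\alpha}]=\mp k\,x_{\pm k\alpha},\quad [x_{-k\alpha},x_{k\alpha}]=h\ (k=1,2),\quad [x_{\pm\alpha},x_{\pm\alpha}]=\mp 2x_{\pm2\alpha},\quad [x_{\pm\alpha},x_{\mp2\alpha}]=x_{\mp\alpha},\quad [x_{\pm2\alpha},x_{\pm\alpha}]=0.$$ Let $\mathfrak G=\mathfrak{osp}(1|2)\times\mathfrak{osp}(1|2)$, so that $U(\mathfrak G)\cong U(\mathfrak{osp}(1|2))\otimes U(\mathfrak{osp}(1|2))$, and write $X_\beta=x_\beta\otimes1+1\otimes x_\beta$ and $H=h\otimes 1+1\otimes h$. Let $U$ be the localization of $U(\mathfrak G)$ at all $H-n$, $n\in\mathbb Z$, that is, $U=R\otimes_{\mathbb C[H]}U(\mathfrak G)$ with $R=\mathbb C[H][(H-n)^{-1}\mid n\in\mathbb Z]$. Let $I=UX_\alpha+UX_{2\alpha}$ and $N_U(I)=\{u\in U\mid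 Iu\subseteq I\}$. The diagonal reduction algebra of $\mathfrak{osp}(1|2)$ is the superalgebra $A=N_U(I)/I$, with the $\mathbb Z_2$-grading induced from $U$. For an associative superalgebra $B=B_{\bar0}\oplus B_{\bar1}$ over $\mathbb{C}$ and $i,k\in\mathbb Z_2$, let $B_{(i,k)}$ be the space of all $a\in B_i$ with $ab=(-1)^{(i+k)j}ba$ for all $j\in\mathbb Z_2$ and $b\in B_j$. Thus $B_{(\bar0,\bar0)}+B_{(\bar1,\bar0)}$ is the (super) center of $B$ and $B_{(\bar0,\bar1)}+B_{(\bar1,\bar1)}$ is the anti-center of $B$; the sum of the center and the anti-center is a subalgebra, the ghost center of $B$. Let $$C=x_{-2\alpha}x_{2\alpha}-\tfrac12x_{-\alpha}x_\alpha+\tfrac14(h^2-h)+\tfrac1{16},\qquad Q=\tfrac12h-x_{-\alpha}x_\alpha-\tfrac14$$ be the Casimir and the Scasimir element of $U(\mathfrak{osp}(1|2))$. The elements $C\otimes1$, $1\otimes C$ and $Q\otimes Q$ lie in $N_U(I)$. Let $C^{(1)},C^{(2)},Q^{(2)}\in A$ be the images of $8(C\otimes1-1\otimes C)$, $8(C\otimes1+1\otimes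 C)$ and $16\,Q\otimes Q$, respectively. **Theorem.** The elements $C^{(1)},C^{(2)},Q^{(2)}$ belong to the ghost center of $A$, and there is an isomorphism of $\mathbb C$-algebras $\phi$ from the ghost center of $A$ onto the subalgebra of $\mathbb C[x,y]$ generated by $x^2+y^2$, $2xy$ and $x^2-y^2$ such that $$\phi(C^{(1)})=2xy,\qquad \phi(C^{(2)})=x^2+y^2,\qquad \phi(Q^{(2)})=x^2-y^2.$$ Moreover $\phi$ is graded: for all $i,k\in\mathbb Z_2$, an element $z$ of the ghost center lies in $A_{(i,k)}$ if and only if $\phi(z)\in\mathbb C[x,y]_{(i,k)}$, where $\mathbb C[x,y]_{(\bar0,k)}=\{f\mid f(x,y)=(-1)^kf(y,x)\}$ and $\mathbb C[x,y]_{(\bar1,k)}=0$. -/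

import Mathlib

noncomputable section

/-! ### Ghost centers of associative superalgebras -/

namespace Superalgebra

variable {B : Type*} [Ring B] [Algebra ℂ B]

/-- Let `B = 𝓑 0 ⊕ 𝓑 1` be an associative superalgebra.
`ghostPart 𝓑 i k` is the space of elements `a` of parity `i` with
`a b = (-1)^((i + k) j) b a` for all `b` of parity `j`.

* For `k = 0` this is the parity-`i` part of the center: `a b = (-1)^(i j) b a`.
* For `k = 1`, `i = 0` it consists of the even elements commuting with the even elements and
  anti-commuting with the odd ones; for `k = 1`, `i = 1` it consists of the odd elements
  commuting with everything. So `ghostPart 𝓑 i 1` is the parity-`i` part of the anti-center. -/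
def ghostPart (𝓑 : ZMod 2 → Submodule ℂ B) (i k : ZMod 2) : Submodule ℂ B where
  carrier := {a | a ∈ 𝓑 i ∧
    ∀ j : ZMod 2, ∀ b ∈ 𝓑 j, a * b = ((-1 : ℤˣ) ^ ((i + k) * j) : ℤˣ) • (b * a)}
  zero_mem' := ⟨zero_mem _, fun j b _ => by simp⟩
  add_mem' := fun {x y} hx hy => ⟨add_mem hx.1 hy.1, fun j b hb => by
    rw [add_mul, mul_add, smul_add, hx.2 j b hb, hy.2 j b hb]⟩
  smul_mem' := fun c x hx => ⟨Submodule.smul_mem _ c hx.1, fun j b hb => by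
    rw [smul_mul_assoc, hx.2 j b hb, mul_smul_comm, smul_comm]⟩

theorem ghostPart_mul (𝓑 : ZMod 2 → Submodule ℂ B) [SetLike.GradedMonoid 𝓑]
    {i k i' k' : ZMod 2} {a a' : B} (ha : a ∈ ghostPart 𝓑 i k) (ha' : a' ∈ ghostPart 𝓑 i' k') :
    a * a' ∈ ghostPart 𝓑 (i + i') (k + k') := by
  refine ⟨SetLike.mul_mem_graded ha.1 ha'.1, fun j b hb => ?_⟩
  have e : (i + i' + (k + k')) * j = (i' + k') * j + (i + k) * j := by ring
  rw [mul_assoc, ha'.2 j b hb, mul_smul_comm, ← mul_assoc, ha.2 j b hb, smul_mul_assoc,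
    mul_assoc, smul_smul, e, uzpow_add]

/-- The ghost center of an associative superalgebra: the sum of the center (`ghostPart 𝓑 i 0`,
`i = 0, 1`) and of the anti-center (`ghostPart 𝓑 i 1`, `i = 0, 1`). -/
def ghostCenter (𝓑 : ZMod 2 → Submodule ℂ B) [SetLike.GradedMonoid 𝓑] : Subalgebra ℂ B :=
  Submodule.toSubalgebra (⨆ p : ZMod 2 × ZMod 2, ghostPart 𝓑 p.1 p.2)
    (Submodule.mem_iSup_of_mem (0, 0)
      ⟨SetLike.one_mem_graded 𝓑, fun j b _ => by simp⟩)
    (by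
      intro x y hx hy
      induction hx using Submodule.iSup_induction' with
      | zero => rw [zero_mul]; exact zero_mem _
      | add x₁ x₂ _ _ h₁ h₂ => rw [add_mul]; exact add_mem h₁ h₂
      | mem p x hx =>
        induction hy using Submodule.iSup_induction' with
        | zero => rw [mul_zero]; exact zero_mem _
        | add y₁ y₂ _ _ h₁ h₂ => rw [mul_add]; exact add_mem h₁ h₂
        | mem q y hy =>
          exact Submodule.mem_iSup_of_mem (p.1 + q.1, p.2 + q.2) (ghostPart_mul 𝓑 hx hy))

end Superalgebra

/-! ### The Lie superalgebra `osp(1|2)` -/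

/-- The standard basis `x_{-2α}, x_{-α}, h, x_α, x_{2α}` of `osp(1|2)`. -/
inductive Osp : Type
  | xm2 | xm1 | h | x1 | x2
  deriving DecidableEq

namespace Osp

instance : Fintype Osp where
  elems := {xm2, xm1, h, x1, x2}
  complete := fun b => by cases b <;> decide

/-- The parity: `x_{±α}` are odd, `x_{±2α}` and `h` are even. -/
def parity : Osp → ZMod 2
  | xm1 => 1
  | x1 => 1
  | _ => 0

/-- The super bracket of two basis vectors of `osp(1|2)`, as a coordinate vector. -/
def bracket : Osp → Osp → Osp → ℂ
  | h, xm2 => Pi.single xm2 2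
  | xm2, h => Pi.single xm2 (-2)
  | h, xm1 => Pi.single xm1 1
  | xm1, h => Pi.single xm1 (-1)
  | h, x1 => Pi.single x1 (-1)
  | x1, h => Pi.single x1 1
  | h, x2 => Pi.single x2 (-2)
  | x2, h => Pi.single x2 2
  | xm2, x2 => Pi.single h 1
  | x2, xm2 => Pi.single h (-1)
  | xm1, x1 => Pi.single h 1
  | x1, xm1 => Pi.single h 1
  | x1, x1 => Pi.single x2 (-2)
  | xm1, xm1 => Pi.single xm2 2
  | x1, xm2 => Pi.single xm1 1
  | xm2, x1 => Pi.single xm1 (-1)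
  | xm1, x2 => Pi.single x1 1
  | x2, xm1 => Pi.single x1 (-1)
  | _, _ => 0

/-- The Casimir element
`C = x_{-2α} x_{2α} - (1/2) x_{-α} x_α + (1/4) (h² - h) + 1/16` of `osp(1|2)`, evaluated at
elements `x b` of an algebra satisfying the relations of `osp(1|2)`. -/
def casimir {B : Type*} [Ring B] [Algebra ℂ B] (x : Osp → B) : B :=
  x xm2 * x x2 - (1 / 2 : ℂ) • (x xm1 * x x1) + (1 / 4 : ℂ) • (x h * x h - x h)
    + algebraMap ℂ B (1 / 16)

/-- The Scasimir element `Q = (1/2) h - x_{-α} x_α - 1/4` of `osp(1|2)`, evaluated likewise.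
It commutes with the even part of `osp(1|2)`, anti-commutes with the odd part, and `Q² = C`. -/
def scasimir {B : Type*} [Ring B] [Algebra ℂ B] (x : Osp → B) : B :=
  (1 / 2 : ℂ) • x h - x xm1 * x x1 - algebraMap ℂ B (1 / 4)

end Osp

/-! ### The diagonal reduction algebra of `osp(1|2)` -/

namespace DiagRed

open Osp

/-- Generators of the localized enveloping algebra of `𝔊 = osp(1|2) × osp(1|2)`:
`base i b` is the basis vector `b` of the `i`-th factor, and `inv n` is the
inverse of `H - n`. -/
inductive Gen : Type
  | base (i : Fin 2) (b : Osp)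
  | inv (n : ℤ)

/-- The parity of the generators. -/
def Gen.parity : Gen → ZMod 2
  | .base _ b => b.parity
  | .inv _ => 0

/-- A basis vector of `𝔊`, in the free algebra. -/
def genF (i : Fin 2) (b : Osp) : FreeAlgebra ℂ Gen := FreeAlgebra.ι ℂ (Gen.base i b)

/-- `H - n`, where `H = h ⊗ 1 + 1 ⊗ h`, in the free algebra. -/
def shiftF (n : ℤ) : FreeAlgebra ℂ Gen := genF 0 h + genF 1 h - algebraMap ℂ _ (n : ℂ)

/-- The defining relations: `a b - (-1)^(|a| |b|) b a = [a, b]` for basis vectors `a`, `b` of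
`𝔊` (in particular the two factors super-commute), and `inv n` is inverse to `H - n`. -/
inductive Rel : FreeAlgebra ℂ Gen → FreeAlgebra ℂ Gen → Prop
  | bracket_same (i : Fin 2) (a b : Osp) :
      Rel (genF i a * genF i b)
        (((-1 : ℤˣ) ^ (a.parity * b.parity) : ℤˣ) • (genF i b * genF i a)
          + ∑ c : Osp, Osp.bracket a b c • genF i c)
  | bracket_ne (i j : Fin 2) (hij : i ≠ j) (a b : Osp) :
      Rel (genF i a * genF j b)
        (((-1 : ℤˣ) ^ (a.parity * b.parity) : ℤˣ) • (genF j b * genF i a))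
  | shift_inv (n : ℤ) : Rel (shiftF n * FreeAlgebra.ι ℂ (Gen.inv n)) 1
  | inv_shift (n : ℤ) : Rel (FreeAlgebra.ι ℂ (Gen.inv n) * shiftF n) 1

/-- `U = R ⊗_{U(ℂ H)} U(𝔊)`, where `R = ℂ[H][(H - n)⁻¹ : n ∈ ℤ]`: the universal enveloping
algebra of the Lie superalgebra `𝔊 = osp(1|2) × osp(1|2)`, with all `H - n` inverted. -/
def U : Type := (ringConGen Rel).Quotient
  deriving Ring, Algebra ℂ

/-- The quotient map onto `U`. -/
def mkU : FreeAlgebra ℂ Gen →ₐ[ℂ] U := RingCon.mkₐ ℂ (ringConGen Rel)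

theorem mkU_rel {a b : FreeAlgebra ℂ Gen} (hab : Rel a b) : mkU a = mkU b :=
  Quotient.sound (RingCon.le_ringConGen _ _ hab)

/-- The images of the generators in `U`. -/
def gen (g : Gen) : U := mkU (FreeAlgebra.ι ℂ g)

/-- `el 0 b = b ⊗ 1` and `el 1 b = 1 ⊗ b`, under `U(𝔊) ≅ U(osp(1|2)) ⊗ U(osp(1|2))`. -/
def el (i : Fin 2) (b : Osp) : U := gen (Gen.base i b)

/-- The diagonal copy `X b = b ⊗ 1 + 1 ⊗ b` of `osp(1|2)`. -/
def X (b : Osp) : U := el 0 b + el 1 b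

/-- The parity grading of `U`: the part of parity `i` is spanned by the products of generators
with total parity `i`. -/
def uPart (i : ZMod 2) : Submodule ℂ U :=
  Submodule.span ℂ {u | ∃ l : List Gen, (l.map Gen.parity).sum = i ∧ u = (l.map gen).prod}

/-- The left ideal `I = U 𝔑₊` generated by `𝔑₊ = ℂ X_α + ℂ X_{2α}`
(`Ideal` means left ideal). -/
def I : Ideal U := Ideal.span {X x1, X x2}

/-- The normalizer `N_U(I) = {n ∈ U : I n ⊆ I}`, the largest subalgebra of `U` in which `I` is a
two-sided ideal. -/
def N : Subalgebra ℂ U where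
  carrier := {n | ∀ a ∈ I, a * n ∈ I}
  mul_mem' := fun {x y} hx hy a ha => by rw [← mul_assoc]; exact hy _ (hx a ha)
  add_mem' := fun {x y} hx hy a ha => by rw [mul_add]; exact add_mem (hx a ha) (hy a ha)
  algebraMap_mem' := fun c a ha => by
    rw [← Algebra.commutes]; exact I.mul_mem_left _ ha

/-- The left ideal `I`, as a subset of its normalizer. -/
def IN : Ideal N := I.comap N.val

instance : IN.IsTwoSided where
  mul_mem_of_left := fun {a} b ha => b.2 a.1 ha

/-- The diagonal reduction algebra `Z = N_U(I) / I` of `osp(1|2)`. -/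
abbrev Z : Type := N ⧸ IN

/-- The class in `Z` of an element of `N_U(I)`. -/
def toZ : N →ₐ[ℂ] Z := Ideal.Quotient.mkₐ ℂ IN

/-- The parity grading of `Z`, induced from the one of `U`. -/
def zPart (i : ZMod 2) : Submodule ℂ Z :=
  ((uPart i).comap N.val.toLinearMap).map toZ.toLinearMap

theorem uPart_one : (1 : U) ∈ uPart 0 := Submodule.subset_span ⟨[], by simp, by simp⟩

theorem uPart_mul {i j : ZMod 2} {a b : U} (ha : a ∈ uPart i) (hb : b ∈ uPart j) :
    a * b ∈ uPart (i + j) := by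
  have h : uPart i * uPart j ≤ uPart (i + j) := by
    unfold uPart
    rw [Submodule.span_mul_span]
    refine Submodule.span_mono ?_
    rintro _ ⟨_, ⟨l, hl, rfl⟩, _, ⟨m, hm, rfl⟩, rfl⟩
    exact ⟨l ++ m, by simp [hl, hm], by simp⟩
  exact h (Submodule.mul_mem_mul ha hb)

instance : SetLike.GradedMonoid zPart where
  one_mem := ⟨1, uPart_one, map_one toZ⟩
  mul_mem := by
    rintro i j _ _ ⟨a, ha, rfl⟩ ⟨b, hb, rfl⟩
    exact ⟨a * b, uPart_mul ha hb, map_mul toZ a b⟩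

/-! ### The Casimir and Scasimir elements of the diagonal reduction algebra -/

theorem el_same (i : Fin 2) (a b : Osp) :
    el i a * el i b = ((-1 : ℤˣ) ^ (a.parity * b.parity) : ℤˣ) • (el i b * el i a)
      + ∑ c : Osp, Osp.bracket a b c • el i c := by
  have := mkU_rel (Rel.bracket_same i a b)
  simpa [genF, el, gen, Units.smul_def] using this

theorem el_ne {i j : Fin 2} (hij : i ≠ j) (a b : Osp) :
    el i a * el j b = ((-1 : ℤˣ) ^ (a.parity * b.parity) : ℤˣ) • (el j b * el i a) := by
  have := mkU_rel (Rel.bracket_ne i j hij a b)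
  simpa [genF, el, gen, Units.smul_def] using this

theorem rel_x1_xm1 (i : Fin 2) : el i x1 * el i xm1 = el i h - el i xm1 * el i x1 := by
  have := el_same i x1 xm1
  simp [Osp.parity, Osp.bracket, Pi.single_apply] at this
  rw [this]; abel

theorem rel_x1_h (i : Fin 2) : el i x1 * el i h = el i h * el i x1 + el i x1 := by
  have := el_same i x1 h
  simpa [Osp.parity, Osp.bracket, Pi.single_apply] using this

theorem rel_x1_xm2 (i : Fin 2) : el i x1 * el i xm2 = el i xm2 * el i x1 + el i xm1 := by
  have := el_same i x1 xm2
  simpa [Osp.parity, Osp.bracket, Pi.single_apply] using this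

theorem rel_x2 (i : Fin 2) : el i x2 = - (el i x1 * el i x1) := by
  have := el_same i x1 x1
  simp [Osp.parity, Osp.bracket, Pi.single_apply] at this
  have h2 : (2 : ℂ) • (el i x1 * el i x1 + el i x2) = 0 := by
    rw [smul_add, two_smul]
    nth_rewrite 2 [this]
    abel
  have h3 := (smul_eq_zero_iff_right (two_ne_zero)).1 h2
  exact eq_neg_of_add_eq_zero_right h3

theorem casimir_same (i : Fin 2) : el i x1 * casimir (el i) = casimir (el i) * el i x1 := by
  simp only [casimir, rel_x2, mul_add, mul_sub, add_mul, sub_mul, mul_smul_comm, smul_mul_assoc,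
    mul_neg, neg_mul, ← Algebra.commutes]
  have e1 : el i x1 * (el i xm2 * (el i x1 * el i x1))
      = el i xm2 * (el i x1 * el i x1) * el i x1 + el i xm1 * (el i x1 * el i x1) := by
    rw [← mul_assoc, rel_x1_xm2]; noncomm_ring
  have e2 : el i x1 * (el i xm1 * el i x1)
      = el i h * el i x1 - el i xm1 * (el i x1 * el i x1) := by
    rw [← mul_assoc, rel_x1_xm1]; noncomm_ring
  have e3 : el i x1 * (el i h * el i h)
      = el i h * el i h * el i x1 + (2 : ℂ) • (el i h * el i x1) + el i x1 := by
    rw [← mul_assoc, rel_x1_h, add_mul, mul_assoc, rel_x1_h, two_smul]; noncomm_ring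
  rw [e1, e2, e3, rel_x1_h, mul_assoc (el i xm1)]
  module

theorem scasimir_same (i : Fin 2) :
    el i x1 * scasimir (el i) = - (scasimir (el i) * el i x1) := by
  have e2 : el i x1 * (el i xm1 * el i x1)
      = el i h * el i x1 - el i xm1 * el i x1 * el i x1 := by
    rw [← mul_assoc, rel_x1_xm1]; noncomm_ring
  simp only [scasimir, mul_sub, sub_mul, mul_smul_comm, smul_mul_assoc, ← Algebra.commutes,
    rel_x1_h, e2, ← Algebra.smul_def]
  module

theorem casimir_ne {i j : Fin 2} (hij : i ≠ j) :
    el j x1 * casimir (el i) = casimir (el i) * el j x1 := by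
  have e1 := el_ne hij.symm x1 xm2
  have e2 := el_ne hij.symm x1 xm1
  have e3 := el_ne hij.symm x1 h
  have e4 := el_ne hij.symm x1 x1
  have e5 := el_ne hij.symm x1 x2
  simp [Osp.parity] at e1 e2 e3 e4 e5
  have f1 : el j x1 * (el i xm2 * el i x2) = el i xm2 * el i x2 * el j x1 := by
    rw [← mul_assoc, e1, mul_assoc, e5, mul_assoc]
  have f2 : el j x1 * (el i xm1 * el i x1) = el i xm1 * el i x1 * el j x1 := by
    rw [← mul_assoc, e2, neg_mul, mul_assoc, e4, mul_neg, neg_neg, mul_assoc]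
  have f3 : el j x1 * (el i h * el i h) = el i h * el i h * el j x1 := by
    rw [← mul_assoc, e3, mul_assoc, e3, mul_assoc]
  simp only [casimir, mul_add, mul_sub, add_mul, sub_mul, mul_smul_comm, smul_mul_assoc,
    ← Algebra.commutes, f1, f2, f3, e3]

theorem scasimir_ne {i j : Fin 2} (hij : i ≠ j) :
    el j x1 * scasimir (el i) = scasimir (el i) * el j x1 := by
  have e2 := el_ne hij.symm x1 xm1
  have e3 := el_ne hij.symm x1 h
  have e4 := el_ne hij.symm x1 x1
  simp [Osp.parity] at e2 e3 e4
  have f2 : el j x1 * (el i xm1 * el i x1) = el i xm1 * el i x1 * el j x1 := by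
    rw [← mul_assoc, e2, neg_mul, mul_assoc, e4, mul_neg, neg_neg, mul_assoc]
  simp only [scasimir, mul_sub, sub_mul, mul_smul_comm, smul_mul_assoc,
    ← Algebra.commutes, f2, e3]

theorem X_x2 : X x2 = - (X x1 * X x1) := by
  have e := el_ne (show (0 : Fin 2) ≠ 1 by decide) x1 x1
  simp [Osp.parity] at e
  simp only [X, rel_x2, add_mul, mul_add, e]
  abel

/-- An element commuting or anti-commuting with `X_α` normalizes `I`. -/
theorem mem_N {n : U} (hn : X x1 * n = n * X x1 ∨ X x1 * n = - (n * X x1)) : n ∈ N := by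
  have h2 : X x2 * n = n * X x2 := by
    rw [X_x2]
    rcases hn with hn | hn
    · rw [neg_mul, mul_assoc, hn, ← mul_assoc, hn]; noncomm_ring
    · rw [neg_mul, mul_assoc, hn, mul_neg, ← mul_assoc, hn]; noncomm_ring
  have m1 : X x1 ∈ I := Ideal.subset_span (by simp)
  have m2 : X x2 ∈ I := Ideal.subset_span (by simp)
  intro a ha
  induction ha using Submodule.span_induction with
  | mem a ha =>
    rcases ha with rfl | rfl
    · rcases hn with hn | hn
      · rw [hn]; exact I.mul_mem_left _ m1
      · rw [hn]; exact neg_mem (I.mul_mem_left _ m1)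
    · rw [h2]; exact I.mul_mem_left _ m2
  | zero => rw [zero_mul]; exact zero_mem _
  | add a b _ _ iha ihb => rw [add_mul]; exact add_mem iha ihb
  | smul c a _ ih => rw [smul_eq_mul, mul_assoc]; exact I.mul_mem_left _ ih

theorem casimir_mem (i : Fin 2) : casimir (el i) ∈ N := by
  refine mem_N (Or.inl ?_)
  fin_cases i
  · simp only [X, add_mul, mul_add, Fin.zero_eta, casimir_same, casimir_ne (zero_ne_one' (Fin 2))]
  · simp only [X, add_mul, mul_add, Fin.mk_one, casimir_same, casimir_ne (one_ne_zero' (Fin 2))]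

theorem scasimir_mem : scasimir (el 0) * scasimir (el 1) ∈ N := by
  refine mem_N (Or.inr ?_)
  simp only [X, add_mul, mul_add]
  rw [← mul_assoc, ← mul_assoc, scasimir_same, scasimir_ne (zero_ne_one' (Fin 2)), mul_assoc _ (el 1 x1),
    scasimir_same, neg_mul, mul_assoc _ (el 0 x1), scasimir_ne (one_ne_zero' (Fin 2))]
  noncomm_ring

/-- `C⁽¹⁾`: `8` times the image of `C ⊗ 1 - 1 ⊗ C`. -/
def C1 : Z := (8 : ℂ) • toZ (⟨casimir (el 0), casimir_mem 0⟩ - ⟨casimir (el 1), casimir_mem 1⟩)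

/-- `C⁽²⁾`: `8` times the image of `C ⊗ 1 + 1 ⊗ C`. -/
def C2 : Z := (8 : ℂ) • toZ (⟨casimir (el 0), casimir_mem 0⟩ + ⟨casimir (el 1), casimir_mem 1⟩)

/-- `Q⁽²⁾`: `16` times the image of `Q ⊗ Q`. -/
def Q2 : Z := (16 : ℂ) • toZ ⟨scasimir (el 0) * scasimir (el 1), scasimir_mem⟩

end DiagRed

/-! ### The target algebra -/

namespace PolySide

open MvPolynomial

/-- The subalgebra of `ℂ[x, y]` generated by `x² + y²`, `2xy`, `x² - y²`
(`x = X 0`, `y = X 1`). -/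
def target : Subalgebra ℂ (MvPolynomial (Fin 2) ℂ) :=
  Algebra.adjoin ℂ {X 0 ^ 2 + X 1 ^ 2, 2 * X 0 * X 1, X 0 ^ 2 - X 1 ^ 2}

/-- The `ℤ₂ × ℤ₂`-grading of `ℂ[x, y]`: the part of degree `(0, b)` consists of the `f` with
`f(x, y) = (-1)^b f(y, x)`, and the part of degree `(1, b)` is zero. -/
def polyPart (i b : ZMod 2) : Set (MvPolynomial (Fin 2) ℂ) :=
  {f | if i = 0 then f = ((-1 : ℤˣ) ^ b : ℤˣ) • rename (Equiv.swap 0 1) f else f = 0}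

end PolySide

namespace DiagRed

open Osp

/-! ### Generators and relations of `U` -/

theorem mkU_surjective : Function.Surjective mkU := RingCon.mkₐ_surjective _

/-- The inverse of `H - n` in `U`. -/
def hinv (n : ℤ) : U := gen (.inv n)

/-- The element `H - n` of `U`. -/
def shift (n : ℤ) : U := X h - algebraMap ℂ U (n : ℂ)

theorem shift_mul_hinv (n : ℤ) : shift n * hinv n = 1 := by
  have := mkU_rel (Rel.shift_inv n)
  rw [map_mul, map_one] at this
  rw [← this]
  simp [shift, shiftF, X, hinv, gen, el, genF]

theorem hinv_mul_shift (n : ℤ) : hinv n * shift n = 1 := by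
  have := mkU_rel (Rel.inv_shift n)
  rw [map_mul, map_one] at this
  rw [← this]
  simp [shift, shiftF, X, hinv, gen, el, genF]

theorem rel_e_e (i : Fin 2) : el i xm2 = el i xm1 * el i xm1 := by
  have := el_same i xm1 xm1
  simp [Osp.parity, Osp.bracket, Pi.single_apply] at this
  have h2 : (2 : ℂ) • (el i xm2 - el i xm1 * el i xm1) = 0 := by
    rw [smul_sub, two_smul ℂ (el i xm1 * el i xm1)]
    nth_rewrite 2 [this]
    abel
  exact sub_eq_zero.1 ((smul_eq_zero_iff_right (two_ne_zero)).1 h2)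

theorem rel_h_e (i : Fin 2) : el i h * el i xm1 = el i xm1 * el i h + el i xm1 := by
  have := el_same i h xm1
  simpa [Osp.parity, Osp.bracket, Pi.single_apply] using this

theorem rel_h (i : Fin 2) : el i h = el i xm1 * el i x1 + el i x1 * el i xm1 := by
  rw [rel_x1_xm1]; abel

/-- The even basis vectors are polynomials in x_α and x_{-α}, so only the odd vectors and the
inverses of H - n have to be treated. -/
theorem U_induction {p : U → Prop} (halg : ∀ c : ℂ, p (algebraMap ℂ U c))
    (he : ∀ i, p (el i xm1)) (hf : ∀ i, p (el i x1)) (hinv : ∀ n, p (hinv n))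
    (hadd : ∀ u v, p u → p v → p (u + v)) (hmul : ∀ u v, p u → p v → p (u * v)) (u : U) : p u := by
  obtain ⟨a, rfl⟩ := mkU_surjective u
  have hneg : ∀ u, p u → p (-u) := fun u hu => by
    have : -u = algebraMap ℂ U (-1) * u := by simp
    rw [this]; exact hmul _ _ (halg _) hu
  induction a using FreeAlgebra.induction with
  | grade0 c => rw [AlgHom.commutes]; exact halg c
  | grade1 g =>
    match g with
    | .inv n => exact hinv n
    | .base i b =>
      change p (el i b)
      cases b with
      | xm2 => rw [rel_e_e]; exact hmul _ _ (he i) (he i)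
      | xm1 => exact he i
      | h => rw [rel_h]; exact hadd _ _ (hmul _ _ (he i) (hf i)) (hmul _ _ (hf i) (he i))
      | x1 => exact hf i
      | x2 => rw [rel_x2]; exact hneg _ (hmul _ _ (hf i) (hf i))
  | mul a b ha hb => rw [map_mul]; exact hmul _ _ ha hb
  | add a b ha hb => rw [map_add]; exact hadd _ _ ha hb

theorem cross_e_e {i j : Fin 2} (hij : i ≠ j) :
    el i xm1 * el j xm1 = -(el j xm1 * el i xm1) := by
  simpa [Osp.parity] using el_ne hij xm1 xm1

theorem cross_e_f {i j : Fin 2} (hij : i ≠ j) :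
    el i xm1 * el j x1 = -(el j x1 * el i xm1) := by
  simpa [Osp.parity] using el_ne hij xm1 x1

theorem cross_f_e {i j : Fin 2} (hij : i ≠ j) :
    el i x1 * el j xm1 = -(el j xm1 * el i x1) := by
  simpa [Osp.parity] using el_ne hij x1 xm1

theorem cross_f_f {i j : Fin 2} (hij : i ≠ j) :
    el i x1 * el j x1 = -(el j x1 * el i x1) := by
  simpa [Osp.parity] using el_ne hij x1 x1

theorem cross_h {i j : Fin 2} (hij : i ≠ j) (b : Osp) : el i h * el j b = el j b * el i h := by
  simpa [Osp.parity] using el_ne hij h b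

/-! ### The universal property of `U` -/

/-- Elements `e i`, `f i`, `w i`, `t n` of an algebra which satisfy the relations of the elements
`x_{-α}`, `x_α`, `h` of the two factors of `𝔊`, and of the inverses of `H - n`. -/
structure Datum (B : Type*) [Ring B] [Algebra ℂ B] where
  e : Fin 2 → B
  f : Fin 2 → B
  w : Fin 2 → B
  t : ℤ → B
  f_e : ∀ i, f i * e i = w i - e i * f i
  w_e : ∀ i, w i * e i = e i * w i + e i
  f_w : ∀ i, f i * w i = w i * f i + f i
  e_e : ∀ i j, i ≠ j → e i * e j = -(e j * e i)
  e_f : ∀ i j, i ≠ j → e i * f j = -(f j * e i)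
  f_f : ∀ i j, i ≠ j → f i * f j = -(f j * f i)
  e_w : ∀ i j, i ≠ j → e i * w j = w j * e i
  w_f : ∀ i j, i ≠ j → w i * f j = f j * w i
  w_w : ∀ i j, i ≠ j → w i * w j = w j * w i
  s_t : ∀ n : ℤ, (w 0 + w 1 - algebraMap ℂ B n) * t n = 1
  t_s : ∀ n : ℤ, t n * (w 0 + w 1 - algebraMap ℂ B n) = 1

namespace Datum

variable {B : Type*} [Ring B] [Algebra ℂ B] (D : Datum B)

/-- The images of the basis vectors of `osp(1|2)`. -/
def basis (i : Fin 2) : Osp → B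
  | xm2 => D.e i * D.e i
  | xm1 => D.e i
  | h => D.w i
  | x1 => D.f i
  | x2 => -(D.f i * D.f i)

/-- All brackets follow from the three relations `f_e`, `w_e`, `f_w`, read as rewriting rules which
put words in the order e, w, f. -/
theorem basis_same (i : Fin 2) (a b : Osp) :
    D.basis i a * D.basis i b
      = ((-1 : ℤˣ) ^ (a.parity * b.parity) : ℤˣ) • (D.basis i b * D.basis i a)
        + ∑ c : Osp, Osp.bracket a b c • D.basis i c := by
  have r1 := D.f_e i
  have r2 := D.w_e i
  have r3 := D.f_w i
  -- The primed rules apply the relations inside right-associated products.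
  have r1' : ∀ x, D.f i * (D.e i * x) = D.w i * x - D.e i * (D.f i * x) := fun x => by
    rw [← mul_assoc, r1, sub_mul, mul_assoc]
  have r2' : ∀ x, D.w i * (D.e i * x) = D.e i * (D.w i * x) + D.e i * x := fun x => by
    rw [← mul_assoc, r2, add_mul, mul_assoc]
  have r3' : ∀ x, D.f i * (D.w i * x) = D.w i * (D.f i * x) + D.f i * x := fun x => by
    rw [← mul_assoc, r3, add_mul, mul_assoc]
  cases a <;> cases b <;>
    simp only [Osp.parity, Osp.bracket, basis, Pi.single_apply, ite_smul, one_smul, zero_smul,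
      Finset.sum_ite_eq', Finset.mem_univ, if_true, Pi.zero_apply, Finset.sum_const_zero, mul_zero,
      mul_one, uzpow_zero, uzpow_one, Units.neg_smul, neg_smul, two_smul, mul_neg, neg_mul,
      mul_assoc, r1, r2, r3, r1', r2', r3', mul_add, mul_sub] <;>
    abel

theorem basis_ne {i j : Fin 2} (hij : i ≠ j) (a b : Osp) :
    D.basis i a * D.basis j b
      = ((-1 : ℤˣ) ^ (a.parity * b.parity) : ℤˣ) • (D.basis j b * D.basis i a) := by
  have r1 := D.e_e i j hij
  have r2 := D.e_f i j hij
  have r3 : D.f i * D.e j = -(D.e j * D.f i) := by rw [D.e_f j i hij.symm, neg_neg]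
  have r4 := D.f_f i j hij
  have r5 := D.e_w i j hij
  have r6 := (D.e_w j i hij.symm).symm
  have r7 := D.w_f i j hij
  have r8 := (D.w_f j i hij.symm).symm
  have r9 := D.w_w i j hij
  have r1' : ∀ x, D.e i * (D.e j * x) = -(D.e j * (D.e i * x)) := fun x => by
    rw [← mul_assoc, r1, neg_mul, mul_assoc]
  have r2' : ∀ x, D.e i * (D.f j * x) = -(D.f j * (D.e i * x)) := fun x => by
    rw [← mul_assoc, r2, neg_mul, mul_assoc]
  have r3' : ∀ x, D.f i * (D.e j * x) = -(D.e j * (D.f i * x)) := fun x => by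
    rw [← mul_assoc, r3, neg_mul, mul_assoc]
  have r4' : ∀ x, D.f i * (D.f j * x) = -(D.f j * (D.f i * x)) := fun x => by
    rw [← mul_assoc, r4, neg_mul, mul_assoc]
  have r6' : ∀ x, D.w i * (D.e j * x) = D.e j * (D.w i * x) := fun x => by
    rw [← mul_assoc, r6, mul_assoc]
  have r7' : ∀ x, D.w i * (D.f j * x) = D.f j * (D.w i * x) := fun x => by
    rw [← mul_assoc, r7, mul_assoc]
  have r5' : ∀ x, D.e i * (D.w j * x) = D.w j * (D.e i * x) := fun x => by
    rw [← mul_assoc, r5, mul_assoc]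
  have r8' : ∀ x, D.f i * (D.w j * x) = D.w j * (D.f i * x) := fun x => by
    rw [← mul_assoc, r8, mul_assoc]
  cases a <;> cases b <;>
    simp only [Osp.parity, basis, mul_zero, mul_one, uzpow_zero, uzpow_one, one_smul,
      Units.neg_smul, mul_neg, neg_mul, neg_neg, mul_assoc, r1, r2, r3, r4, r5, r6, r7, r8, r9, r1',
      r2', r3', r4', r5', r6', r7', r8']

/-- The images of the generators of `U`. -/
def onGen : Gen → B
  | .base i b => D.basis i b
  | .inv n => D.t n

theorem lift_rel {a b : FreeAlgebra ℂ Gen} (hab : Rel a b) :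
    FreeAlgebra.lift ℂ D.onGen a = FreeAlgebra.lift ℂ D.onGen b := by
  cases hab with
  | bracket_same i a b => simpa [genF, onGen, Units.smul_def] using D.basis_same i a b
  | bracket_ne i j hij a b => simpa [genF, onGen, Units.smul_def] using D.basis_ne hij a b
  | shift_inv n => simpa [genF, shiftF, onGen, basis] using D.s_t n
  | inv_shift n => simpa [genF, shiftF, onGen, basis] using D.t_s n

/-- The algebra morphism from `U` given by a datum. -/
def lift : U →ₐ[ℂ] B :=
  (ringConGen Rel).liftₐ (FreeAlgebra.lift ℂ D.onGen)
    (RingCon.ringConGen_le.2 fun _ _ hab => D.lift_rel hab)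

theorem lift_gen (g : Gen) : D.lift (gen g) = D.onGen g := by
  change FreeAlgebra.lift ℂ D.onGen (FreeAlgebra.ι ℂ g) = _
  simp

theorem lift_el (i : Fin 2) (b : Osp) : D.lift (el i b) = D.basis i b := D.lift_gen _

theorem lift_hinv (n : ℤ) : D.lift (hinv n) = D.t n := D.lift_gen _

end Datum

/-! ### Tensor products of Verma modules -/

/-- The coefficient `c_p` in `x_α w_p = c_p w_{p-1}`, where `w_p = x_{-α}^p w_0` and `w_0` is a
highest weight vector with `h w_0 = l w_0`. -/
def lowCoeff (l : ℂ) : ℕ → ℂ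
  | 0 => 0
  | p + 1 => l + p - lowCoeff l p

/-- The odd coefficient vanishes at l = -j: this zero produces the singular vector of degree 2j + 1
in M(-j), and hence the reflection l ↦ 1 - l. -/
theorem lowCoeff_even_odd (l : ℂ) (j : ℕ) :
    lowCoeff l (2 * j) = j ∧ lowCoeff l (2 * j + 1) = l + j := by
  induction j with
  | zero => simp [lowCoeff]
  | succ j ih =>
    have h1 : lowCoeff l (2 * (j + 1)) = (j + 1 : ℕ) := by
      change l + (2 * j + 1 : ℕ) - lowCoeff l (2 * j + 1) = _
      rw [ih.2]; push_cast; ring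
    refine ⟨h1, ?_⟩
    change l + (2 * (j + 1) : ℕ) - lowCoeff l (2 * (j + 1)) = _
    rw [h1]; push_cast; ring

/-- The (completed) tensor product of two Verma modules of `osp(1|2)`: `v p q` is the coefficient
of `w_p ⊗ w_q`. -/
abbrev V : Type := ℕ → ℕ → ℂ

/-- Prepend a zero to a sequence. -/
def pushZero {M : Type*} [Zero M] (v : ℕ → M) : ℕ → M
  | 0 => 0
  | p + 1 => v p

/-- `x_{-α} ⊗ 1` on `V`. -/
def raiseL : Module.End ℂ V where
  toFun v := pushZero v
  map_add' u v := by ext (_ | p) q <;> simp [pushZero]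
  map_smul' c v := by ext (_ | p) q <;> simp [pushZero]

/-- `1 ⊗ x_{-α}` on `V`. -/
def raiseR : Module.End ℂ V where
  -- The sign comes from moving an odd operator past w_p, which has parity p.
  toFun v p q := (-1) ^ p * pushZero (v p) q
  map_add' u v := by ext p (_ | q) <;> simp [pushZero, mul_add]
  map_smul' c v := by ext p (_ | q) <;> simp [pushZero, mul_left_comm]

/-- `x_α ⊗ 1` on `V`. -/
def lowerL (l : ℂ) : Module.End ℂ V where
  toFun v p q := lowCoeff l (p + 1) * v (p + 1) q
  map_add' u v := by ext p q; simp [mul_add]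
  map_smul' c v := by ext p q; simp [mul_left_comm]

/-- `1 ⊗ x_α` on `V`. -/
def lowerR (m : ℂ) : Module.End ℂ V where
  toFun v p q := (-1) ^ p * (lowCoeff m (q + 1) * v p (q + 1))
  map_add' u v := by ext p q; simp [mul_add]
  map_smul' c v := by ext p q; simp [mul_left_comm]

/-- The endomorphism of `V` with eigenvector `w_p ⊗ w_q` of eigenvalue `a p q`. -/
def diag (a : ℕ → ℕ → ℂ) : Module.End ℂ V where
  toFun v p q := a p q * v p q
  map_add' u v := by ext p q; simp [mul_add]
  map_smul' c v := by ext p q; simp [mul_left_comm]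

@[simp] theorem raiseL_zero (v : V) (q : ℕ) : raiseL v 0 q = 0 := rfl
@[simp] theorem raiseL_succ (v : V) (p q : ℕ) : raiseL v (p + 1) q = v p q := rfl
@[simp] theorem raiseR_zero (v : V) (p : ℕ) : raiseR v p 0 = 0 := by simp [raiseR, pushZero]
@[simp] theorem raiseR_succ (v : V) (p q : ℕ) : raiseR v p (q + 1) = (-1) ^ p * v p q := rfl
@[simp] theorem lowerL_apply (l : ℂ) (v : V) (p q : ℕ) :
    lowerL l v p q = lowCoeff l (p + 1) * v (p + 1) q := rfl
@[simp] theorem lowerR_apply (m : ℂ) (v : V) (p q : ℕ) :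
    lowerR m v p q = (-1) ^ p * (lowCoeff m (q + 1) * v p (q + 1)) := rfl
@[simp] theorem diag_apply (a : ℕ → ℕ → ℂ) (v : V) (p q : ℕ) : diag a v p q = a p q * v p q := rfl

/-- The action of the generators of `U` on the tensor product of the Verma modules with highest
weights `l` and `m`. -/
def vermaDatum (l m : ℂ) (hlm : ∀ n : ℤ, l + m ≠ n) : Datum (Module.End ℂ V) where
  e := ![raiseL, raiseR]
  f := ![lowerL l, lowerR m]
  w := ![diag fun p _ => l + p, diag fun _ q => m + q]
  t n := diag fun p q => (l + m + p + q - n)⁻¹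
  f_e i := by
    fin_cases i <;> ext v p q
    · rcases p with _ | p <;> simp [lowCoeff]; ring
    · have e : (-1 : ℂ) ^ p * (-1) ^ p = 1 := by simp [← mul_pow]
      rcases q with _ | q <;> simp [lowCoeff, ← mul_assoc, e]
      · rw [mul_right_comm, e, one_mul]; simp
      · linear_combination ((m + (↑q + 1) - (m + ↑q - lowCoeff m q)) * v p (q + 1)) * e
  w_e i := by
    fin_cases i <;> ext v p q
    · rcases p with _ | p <;> simp; ring
    · rcases q with _ | q <;> simp; ring
  f_w i := by
    fin_cases i <;> ext v p q
    · simp; ring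
    · simp; ring
  e_e i j hij := by
    fin_cases i <;> fin_cases j <;> first | exact absurd rfl hij | skip
    all_goals ext v (_ | p) (_ | q) <;> simp [pow_succ]
  e_f i j hij := by
    fin_cases i <;> fin_cases j <;> first | exact absurd rfl hij | skip
    all_goals ext v (_ | p) (_ | q) <;> simp [pow_succ]
    all_goals ring
  f_f i j hij := by
    fin_cases i <;> fin_cases j <;> first | exact absurd rfl hij | skip
    all_goals ext v p q; simp [pow_succ]; ring
  e_w i j hij := by
    fin_cases i <;> fin_cases j <;> first | exact absurd rfl hij | skip
    all_goals ext v (_ | p) (_ | q) <;> simp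
    all_goals ring
  w_f i j hij := by
    fin_cases i <;> fin_cases j <;> first | exact absurd rfl hij | skip
    all_goals ext v p q; simp; ring
  w_w i j hij := by
    fin_cases i <;> fin_cases j <;> first | exact absurd rfl hij | skip
    all_goals ext v p q; simp; ring
  s_t n := by
    have h0 (p q : ℕ) : l + m + p + q - n ≠ 0 := fun h0 => hlm (n - p - q) (by
      push_cast; linear_combination h0)
    ext v p q
    simp only [Matrix.cons_val_zero, Matrix.cons_val_one, Module.End.mul_apply,
      LinearMap.sub_apply, LinearMap.add_apply, diag_apply, Pi.sub_apply, Pi.add_apply,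
      Module.algebraMap_end_apply, Pi.smul_apply, smul_eq_mul, Module.End.one_apply]
    have := h0 p q
    field_simp
    ring
  t_s n := by
    have h0 (p q : ℕ) : l + m + p + q - n ≠ 0 := fun h0 => hlm (n - p - q) (by
      push_cast; linear_combination h0)
    ext v p q
    simp only [Matrix.cons_val_zero, Matrix.cons_val_one, Module.End.mul_apply,
      LinearMap.sub_apply, LinearMap.add_apply, diag_apply, Pi.sub_apply, Pi.add_apply,
      Module.algebraMap_end_apply, Pi.smul_apply, smul_eq_mul, Module.End.one_apply]
    have := h0 p q
    field_simp
    ring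

/-- The action of `U` on the tensor product of the Verma modules with highest weights `l`, `m`. -/
def verma (l m : ℂ) (hlm : ∀ n : ℤ, l + m ≠ n) : U →ₐ[ℂ] Module.End ℂ V := (vermaDatum l m hlm).lift

section

variable {l m : ℂ} {hlm : ∀ n : ℤ, l + m ≠ n}

@[simp] theorem verma_e_zero : verma l m hlm (el 0 xm1) = raiseL := Datum.lift_el _ _ _
@[simp] theorem verma_e_one : verma l m hlm (el 1 xm1) = raiseR := Datum.lift_el _ _ _
@[simp] theorem verma_f_zero : verma l m hlm (el 0 x1) = lowerL l := Datum.lift_el _ _ _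
@[simp] theorem verma_f_one : verma l m hlm (el 1 x1) = lowerR m := Datum.lift_el _ _ _
@[simp] theorem verma_h_zero : verma l m hlm (el 0 h) = diag fun p _ => l + p := Datum.lift_el _ _ _
@[simp] theorem verma_h_one : verma l m hlm (el 1 h) = diag fun _ q => m + q := Datum.lift_el _ _ _
@[simp] theorem verma_hinv (n : ℤ) :
    verma l m hlm (hinv n) = diag fun p q => (l + m + p + q - n)⁻¹ := Datum.lift_hinv _ _

end

/-- A linear map which intertwines the action of the generators intertwines the action of `U`;
the action on the source may be twisted by an algebra morphism. -/
theorem intertwine {B B' : Type*} [AddCommGroup B] [Module ℂ B] [AddCommGroup B'] [Module ℂ B']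
    (r : U →ₐ[ℂ] Module.End ℂ B) (r' : U →ₐ[ℂ] Module.End ℂ B') (T : B →ₗ[ℂ] B')
    (he : ∀ i v, T (r (el i xm1) v) = r' (el i xm1) (T v))
    (hf : ∀ i v, T (r (el i x1) v) = r' (el i x1) (T v))
    (ht : ∀ n v, T (r (hinv n) v) = r' (hinv n) (T v)) (u : U) :
    ∀ v, T (r u v) = r' u (T v) := by
  induction u using U_induction with
  | halg c => intro v; simp [AlgHom.commutes]
  | he i => exact he i
  | hf i => exact hf i
  | hinv n => exact ht n
  | hadd u v hu hv => intro x; simp [hu, hv]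
  | hmul u v hu hv => intro x; simp [hu, hv]

/-! ### The exchange of the two factors -/

theorem one_sub_ne {i j : Fin 2} (hij : i ≠ j) : (1 - i : Fin 2) ≠ 1 - j := by
  revert i j; decide

/-- The datum of the automorphism of `U` which exchanges the two factors of `𝔊`. -/
def swapDatum : Datum U where
  e i := el (1 - i) xm1
  f i := el (1 - i) x1
  w i := el (1 - i) h
  t := hinv
  f_e i := rel_x1_xm1 _
  w_e i := rel_h_e _
  f_w i := rel_x1_h _
  e_e i j hij := cross_e_e (one_sub_ne hij)
  e_f i j hij := cross_e_f (one_sub_ne hij)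
  f_f i j hij := cross_f_f (one_sub_ne hij)
  e_w i j hij := (cross_h (one_sub_ne hij.symm) _).symm
  w_f i j hij := cross_h (one_sub_ne hij) _
  w_w i j hij := cross_h (one_sub_ne hij) _
  s_t n := by
    rw [← shift_mul_hinv n]; simp [shift, X, add_comm]
  t_s n := by
    rw [← hinv_mul_shift n]; simp [shift, X, add_comm]

/-- The automorphism of `U` which exchanges the two factors of `𝔊`. -/
def swap : U →ₐ[ℂ] U := swapDatum.lift

theorem swap_hinv (n : ℤ) : swap (hinv n) = hinv n := Datum.lift_hinv _ _

theorem swap_el (i : Fin 2) (b : Osp) : swap (el i b) = el (1 - i) b := by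
  rw [swap, Datum.lift_el]
  cases b with
  | xm2 => exact (rel_e_e _).symm
  | x2 => exact (rel_x2 _).symm
  | _ => rfl

theorem swap_X (b : Osp) : swap (X b) = X b := by
  simp [X, swap_el, add_comm]

theorem swap_mem_I {u : U} (hu : u ∈ I) : swap u ∈ I := by
  induction hu using Submodule.span_induction with
  | mem a ha =>
    rcases ha with rfl | rfl
    · rw [swap_X]; exact Ideal.subset_span (by simp)
    · rw [swap_X]; exact Ideal.subset_span (by simp)
  | zero => rw [map_zero]; exact zero_mem _
  | add a b _ _ ha hb => rw [map_add]; exact add_mem ha hb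
  | smul c a _ ha => rw [smul_eq_mul, map_mul]; exact I.mul_mem_left _ ha

/-- The exchange of the factors of `V`. -/
def swapV : Module.End ℂ V where
  toFun v p q := (-1) ^ (p * q) * v q p
  map_add' u v := by ext p q; simp [mul_add]
  map_smul' c v := by ext p q; simp [mul_left_comm]

@[simp] theorem swapV_apply (v : V) (p q : ℕ) : swapV v p q = (-1) ^ (p * q) * v q p := rfl

/-- The signed flip identifies M(l) ⊗ M(m) with M(m) ⊗ M(l) twisted by `swap`. It transfers the
symmetry found in l to m. -/
theorem swapV_verma {l m : ℂ} (hlm : ∀ n : ℤ, l + m ≠ n) (hml : ∀ n : ℤ, m + l ≠ n) (u : U)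
    (v : V) : swapV (verma l m hlm u v) = verma m l hml (swap u) (swapV v) := by
  have e (p : ℕ) : (-1 : ℂ) ^ p * (-1) ^ p = 1 := by simp [← mul_pow]
  refine intertwine (verma l m hlm) ((verma m l hml).comp swap) swapV ?_ ?_ ?_ u v
  · intro i v
    fin_cases i <;> ext (_ | p) (_ | q) <;> simp [swap_el, mul_add, add_mul, pow_add]
    · ring
    · linear_combination ((-1) ^ (p * q) * (-1) ^ p * v (q + 1) p) * e q
  · intro i v
    fin_cases i <;> ext p q <;> simp [swap_el, mul_add, add_mul, pow_add]
    · linear_combination (-(-1) ^ (p * q) * lowCoeff l (q + 1) * v (q + 1) p) * e p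
    · ring
  · intro n v
    ext p q
    simp [swap_hinv]
    ring_nf

/-! ### Embeddings between Verma modules -/

/-- The embedding of the Verma module with highest weight `k + 1` into the one with highest
weight `-k`, tensored with a Verma module. -/
def shiftV (k : ℕ) : Module.End ℂ V where
  -- The shift by 2k + 1 changes the parity of p and so flips the signs of the second factor; the
  -- sign (-1)^q compensates.
  toFun v p q := if p < 2 * k + 1 then 0 else (-1) ^ q * v (p - (2 * k + 1)) q
  map_add' u v := by ext p q; simp only [Pi.add_apply]; split_ifs <;> simp [mul_add]
  map_smul' c v := by
    ext p q; simp only [Pi.smul_apply]; split_ifs <;> simp [mul_left_comm]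

theorem shiftV_apply (k : ℕ) (v : V) (p q : ℕ) :
    shiftV k v p q = if p < 2 * k + 1 then 0 else (-1) ^ q * v (p - (2 * k + 1)) q := rfl

theorem shiftV_lt {k p : ℕ} (hp : p < 2 * k + 1) (v : V) (q : ℕ) : shiftV k v p q = 0 :=
  if_pos hp

theorem shiftV_add (k p : ℕ) (v : V) (q : ℕ) :
    shiftV k v (p + (2 * k + 1)) q = (-1) ^ q * v p q := by
  rw [shiftV_apply, if_neg (by omega), Nat.add_sub_cancel]

/-- Both sides satisfy the same recursion, as -k + (p + 2k + 1) = (k + 1) + p, and both start at 0.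
-/
theorem lowCoeff_reflect (k p : ℕ) :
    lowCoeff (-k) (p + (2 * k + 1)) = lowCoeff (k + 1) p := by
  induction p with
  | zero => rw [zero_add, (lowCoeff_even_odd _ _).2]; simp [lowCoeff]
  | succ p ih =>
    rw [add_right_comm, lowCoeff, lowCoeff, ih]; push_cast; ring

theorem shiftV_verma (k : ℕ) {m : ℂ} (h1 : ∀ n : ℤ, (k + 1 : ℂ) + m ≠ n)
    (h2 : ∀ n : ℤ, (-k : ℂ) + m ≠ n) (u : U) (v : V) :
    shiftV k (verma (k + 1) m h1 u v) = verma (-k) m h2 u (shiftV k v) := by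
  have e2 : (-1 : ℂ) ^ (2 * k) = 1 := by simp
  refine intertwine (verma (k + 1) m h1) (verma (-k) m h2) (shiftV k) ?_ ?_ ?_ u v
  · intro i v
    fin_cases i
    · ext p q
      rcases p with _ | p
      · simp [shiftV_lt]
      rcases lt_or_ge p (2 * k + 1) with hp | hp
      · rcases (Nat.lt_succ_iff.1 hp).eq_or_lt with rfl | hp'
        · have := shiftV_add k 0 (raiseL v) q
          rw [zero_add] at this
          simp [this, shiftV_lt]
        · simp [shiftV_lt (Nat.succ_lt_succ hp'), shiftV_lt hp]
      · obtain ⟨r, rfl⟩ := Nat.exists_eq_add_of_le' hp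
        have := shiftV_add k (r + 1) (raiseL v) q
        rw [add_right_comm] at this
        simp [this, shiftV_add]
    · ext p (_ | q) <;> rcases lt_or_ge p (2 * k + 1) with hp | hp
      · simp [shiftV_lt hp]
      · obtain ⟨r, rfl⟩ := Nat.exists_eq_add_of_le' hp
        simp [shiftV_add]
      · simp [shiftV_lt hp]
      · obtain ⟨r, rfl⟩ := Nat.exists_eq_add_of_le' hp
        simp [shiftV_add, pow_add, pow_succ, e2]
        ring
  · intro i v
    fin_cases i
    · ext p q
      rcases lt_or_ge p (2 * k + 1) with hp | hp
      -- The boundary case is p = 2k, where the coefficient of x_α on w_{2k+1} is zero.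
      · rcases (Nat.lt_succ_iff.1 hp).eq_or_lt with rfl | hp'
        · have := lowCoeff_reflect k 0
          rw [zero_add] at this
          simp only [Fin.zero_eta, verma_f_zero, lowerL_apply, this]
          simp [shiftV_lt, lowCoeff]
        · simp [shiftV_lt (Nat.succ_lt_succ hp'), shiftV_lt hp]
      · obtain ⟨r, rfl⟩ := Nat.exists_eq_add_of_le' hp
        have e3 := shiftV_add k (r + 1) v q
        have e4 := lowCoeff_reflect k (r + 1)
        rw [add_right_comm] at e3 e4
        simp [e3, e4, shiftV_add]
        ring
    · ext p q
      rcases lt_or_ge p (2 * k + 1) with hp | hp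
      · simp [shiftV_lt hp]
      · obtain ⟨r, rfl⟩ := Nat.exists_eq_add_of_le' hp
        simp [shiftV_add, pow_add, pow_succ, e2]
        ring
  · intro n v
    ext p q
    rcases lt_or_ge p (2 * k + 1) with hp | hp
    · simp [shiftV_lt hp]
    · obtain ⟨r, rfl⟩ := Nat.exists_eq_add_of_le' hp
      simp [shiftV_add]
      ring_nf

/-! ### Commutation with the diagonal elements -/

theorem h_add_eq_X : el 0 h + el 1 h = X h := rfl

theorem X_f_e (i : Fin 2) : X x1 * el i xm1 = el i h - el i xm1 * X x1 := by
  fin_cases i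
  · simp only [X, Fin.zero_eta, add_mul, mul_add, rel_x1_xm1, cross_f_e (one_ne_zero' (Fin 2))]; abel
  · simp only [X, Fin.mk_one, add_mul, mul_add, rel_x1_xm1, cross_f_e (zero_ne_one' (Fin 2))]; abel

theorem X_f_h (i : Fin 2) : X x1 * el i h = el i h * X x1 + el i x1 := by
  fin_cases i
  · simp only [X, Fin.zero_eta, add_mul, mul_add, rel_x1_h, cross_h (zero_ne_one' (Fin 2))]; abel
  · simp only [X, Fin.mk_one, add_mul, mul_add, rel_x1_h, cross_h (one_ne_zero' (Fin 2))]; abel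

theorem X_f_f (i : Fin 2) : X x1 * el i x1 = 2 * (el i x1 * el i x1) - el i x1 * X x1 := by
  fin_cases i
  · simp only [X, Fin.zero_eta, add_mul, mul_add, cross_f_f (one_ne_zero' (Fin 2)), two_mul]; abel
  · simp only [X, Fin.mk_one, add_mul, mul_add, cross_f_f (zero_ne_one' (Fin 2)), two_mul]; abel

theorem X_f_f_f (i : Fin 2) : X x1 * (el i x1 * el i x1) = el i x1 * el i x1 * X x1 := by
  rw [← mul_assoc, X_f_f, sub_mul, mul_assoc _ (X x1), X_f_f]; noncomm_ring

theorem X_h_e (i : Fin 2) : X h * el i xm1 = el i xm1 * X h + el i xm1 := by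
  fin_cases i
  · simp only [X, Fin.zero_eta, add_mul, mul_add, rel_h_e, cross_h (one_ne_zero' (Fin 2))]; abel
  · simp only [X, Fin.mk_one, add_mul, mul_add, rel_h_e, cross_h (zero_ne_one' (Fin 2))]; abel

theorem X_h_f (i : Fin 2) : X h * el i x1 = el i x1 * X h - el i x1 := by
  fin_cases i
  · simp only [X, Fin.zero_eta, add_mul, mul_add, rel_x1_h, cross_h (one_ne_zero' (Fin 2))]; abel
  · simp only [X, Fin.mk_one, add_mul, mul_add, rel_x1_h, cross_h (zero_ne_one' (Fin 2))]; abel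

theorem X_h_h (i : Fin 2) : X h * el i h = el i h * X h := by
  fin_cases i
  · simp only [X, Fin.zero_eta, add_mul, mul_add, cross_h (one_ne_zero' (Fin 2))]
  · simp only [X, Fin.mk_one, add_mul, mul_add, cross_h (zero_ne_one' (Fin 2))]

theorem X_f_X_e : X x1 * X xm1 = X h - X xm1 * X x1 := by
  rw [show X xm1 = el 0 xm1 + el 1 xm1 from rfl, mul_add, X_f_e, X_f_e, ← h_add_eq_X]; noncomm_ring

theorem X_h_X_e : X h * X xm1 = X xm1 * X h + X xm1 := by
  rw [show X xm1 = el 0 xm1 + el 1 xm1 from rfl, mul_add, X_h_e, X_h_e]; noncomm_ring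

theorem X_f_X_h : X x1 * X h = X h * X x1 + X x1 := by
  rw [show X h = el 0 h + el 1 h from rfl, mul_add, X_f_h, X_f_h]; simp only [X]; noncomm_ring

/-- `H - n` moves past an element of weight `k` for `H`. -/
theorem shift_mul_of_weight {a : U} {k : ℤ} (ha : X h * a = a * X h + (k : ℂ) • a) (n : ℤ) :
    shift n * a = a * shift (n - k) := by
  simp only [shift, sub_mul, mul_sub, ha, ← Algebra.commutes, ← Algebra.smul_def]
  push_cast
  module

theorem hinv_mul_of_weight {a : U} {k : ℤ} (ha : X h * a = a * X h + (k : ℂ) • a) (n : ℤ) :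
    hinv n * a = a * hinv (n - k) := by
  calc hinv n * a = hinv n * (a * shift (n - k)) * hinv (n - k) := by
        rw [mul_assoc, mul_assoc, shift_mul_hinv, mul_one]
    _ = a * hinv (n - k) := by
        rw [← shift_mul_of_weight ha, ← mul_assoc, hinv_mul_shift, one_mul]

theorem X_f_hinv (n : ℤ) : X x1 * hinv n = hinv (n - 1) * X x1 := by
  rw [hinv_mul_of_weight (k := -1) (by rw [X_f_X_h]; simp)]; simp

theorem X_h_hinv (n : ℤ) : X h * hinv n = hinv n * X h := by
  have h1 : shift n * hinv n = hinv n * shift n := by rw [shift_mul_hinv, hinv_mul_shift]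
  rwa [shift, sub_mul, mul_sub, Algebra.commutes, sub_left_inj] at h1

theorem X_f_mem : X x1 ∈ I := Ideal.subset_span (by simp)

/-- Since X_{2α} = -X_α², membership in N only has to be tested on X_α. -/
theorem mem_N_of_X_f_mul_mem {u : U} (hu : X x1 * u ∈ I) : u ∈ N := by
  intro a ha
  induction ha using Submodule.span_induction with
  | mem a ha =>
    rcases ha with rfl | rfl
    · exact hu
    · rw [X_x2, neg_mul, mul_assoc]; exact neg_mem (I.mul_mem_left _ hu)
  | zero => rw [zero_mul]; exact zero_mem _
  | add a b _ _ iha ihb => rw [add_mul]; exact add_mem iha ihb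
  | smul c a _ ih => rw [smul_eq_mul, mul_assoc]; exact I.mul_mem_left _ ih

/-! ### Lowering operators in the normalizer -/

/-- The element of `N` which the extremal projector of the diagonal `osp(1|2)` attaches to `x_{-α}`
of the factor `i`. -/
def lowering (i : Fin 2) : U :=
  el i xm1 - X xm1 * (hinv 0 * el i h) - X xm1 * (X xm1 * (hinv (-1) * el i x1))
    + 2 * (X xm1 * (X xm1 * (X xm1 * (hinv (-1) * (hinv (-2) * (el i x1 * el i x1))))))

/-- Successive super brackets with X_α send x_{-α} of factor i to h, then x_α, then 2x_α², then 0;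
this is why the series in powers of X_{-α} stops at the third. The denominators make everything
cancel except left multiples of X_α. -/
theorem lowering_mem_N (i : Fin 2) : lowering i ∈ N := by
  apply mem_N_of_X_f_mul_mem
  have hE (x : U) : X x1 * (X xm1 * x) = X h * x - X xm1 * (X x1 * x) := by
    rw [← mul_assoc, X_f_X_e, sub_mul, mul_assoc]
  have hHE (x : U) : X h * (X xm1 * x) = X xm1 * (X h * x) + X xm1 * x := by
    rw [← mul_assoc, X_h_X_e, add_mul, mul_assoc]
  have hFt (n : ℤ) (x : U) : X x1 * (hinv n * x) = hinv (n - 1) * (X x1 * x) := by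
    rw [← mul_assoc, X_f_hinv, mul_assoc]
  have hHt (n : ℤ) (x : U) : X h * (hinv n * x) = x + (n : ℂ) • (hinv n * x) := by
    have := shift_mul_hinv n
    rw [shift, sub_mul, ← Algebra.smul_def, sub_eq_iff_eq_add] at this
    rw [← mul_assoc, this, add_mul, one_mul, smul_mul_assoc]
  -- The left factor is minus `lowering i` with every index of `hinv` decreased by one, which is the
  -- effect of moving the odd element X_α through it.
  have key : X x1 * lowering i
      = (-el i xm1 + X xm1 * (hinv (-1) * el i h) + X xm1 * (X xm1 * (hinv (-2) * el i x1))
        - 2 * (X xm1 * (X xm1 * (X xm1 * (hinv (-2) * (hinv (-3) * (el i x1 * el i x1)))))))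
        * X x1 := by
    simp only [lowering, mul_add, mul_sub, add_mul, sub_mul, neg_mul, mul_assoc, hE, hHE, hFt,
      X_f_e, X_f_h, X_f_f, X_f_f_f, hHt, two_mul, mul_smul_comm,
      show (0 : ℤ) - 1 = -1 by norm_num, show (-1 : ℤ) - 1 = -2 by norm_num,
      show (-2 : ℤ) - 1 = -3 by norm_num]
    push_cast
    module
  rw [key]
  exact I.mul_mem_left _ X_f_mem

theorem X_h_lowering (i : Fin 2) : X h * lowering i = lowering i * X h + lowering i := by
  have hHE (x : U) : X h * (X xm1 * x) = X xm1 * (X h * x) + X xm1 * x := by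
    rw [← mul_assoc, X_h_X_e, add_mul, mul_assoc]
  have hHt (n : ℤ) (x : U) : X h * (hinv n * x) = hinv n * (X h * x) := by
    rw [← mul_assoc, X_h_hinv, mul_assoc]
  have hHf (x : U) : X h * (el i x1 * x) = el i x1 * (X h * x) - el i x1 * x := by
    rw [← mul_assoc, X_h_f, sub_mul, mul_assoc]
  simp only [lowering, mul_add, mul_sub, add_mul, sub_mul, mul_assoc, hHE, hHt, hHf, X_h_e, X_h_f,
    X_h_h, two_mul]
  abel

/-! ### Parity of the lowering operators and their exchange -/

theorem gen_mem_uPart (g : Gen) : gen g ∈ uPart g.parity :=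
  Submodule.subset_span ⟨[g], by simp, by simp⟩

theorem el_mem_uPart (i : Fin 2) (b : Osp) : el i b ∈ uPart b.parity :=
  gen_mem_uPart (.base i b)

theorem X_mem_uPart (b : Osp) : X b ∈ uPart b.parity :=
  add_mem (el_mem_uPart 0 b) (el_mem_uPart 1 b)

theorem hinv_mem_uPart (n : ℤ) : hinv n ∈ uPart 0 := gen_mem_uPart (.inv n)

theorem lowering_mem_uPart (i : Fin 2) : lowering i ∈ uPart 1 := by
  have hX : X xm1 ∈ uPart 1 := X_mem_uPart xm1
  have hf : el i x1 ∈ uPart 1 := el_mem_uPart i x1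
  have hh : el i h ∈ uPart 0 := el_mem_uPart i h
  have ht := hinv_mem_uPart
  have m {a b c : ZMod 2} (hc : a + b = c) {x y : U} (hx : x ∈ uPart a) (hy : y ∈ uPart b) :
      x * y ∈ uPart c := hc ▸ uPart_mul hx hy
  have e00 : (0 + 0 : ZMod 2) = 0 := by decide
  have e01 : (0 + 1 : ZMod 2) = 1 := by decide
  have e10 : (1 + 0 : ZMod 2) = 1 := by decide
  have e11 : (1 + 1 : ZMod 2) = 0 := by decide
  rw [lowering, two_mul]
  have h4 : X xm1 * (X xm1 * (X xm1 * (hinv (-1) * (hinv (-2) * (el i x1 * el i x1))))) ∈ uPart 1 :=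
    m e10 hX (m e11 hX (m e10 hX (m e00 (ht _) (m e00 (ht _) (m e11 hf hf)))))
  exact add_mem (sub_mem (sub_mem (el_mem_uPart i xm1) (m e10 hX (m e00 (ht _) hh)))
    (m e10 hX (m e11 hX (m e01 (ht _) hf)))) (add_mem h4 h4)

theorem swap_lowering (i : Fin 2) : swap (lowering i) = lowering (1 - i) := by
  have h2 : swap 2 = 2 := map_ofNat _ 2
  simp [lowering, swap_el, swap_X, swap_hinv, h2]

/-! ### Singular vectors -/

/-- The highest weight vector of `V`. -/
def hwVec : V := fun p q => if p = 0 ∧ q = 0 then 1 else 0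

theorem hwVec_zero : hwVec 0 0 = 1 := by simp [hwVec]

section

variable {l m : ℂ} {hlm : ∀ n : ℤ, l + m ≠ n}

@[simp] theorem verma_X_h :
    verma l m hlm (X h) = diag fun p q => l + m + p + q := by
  ext v p q; simp [X]; ring

theorem verma_X_f_apply (v : V) (p q : ℕ) :
    verma l m hlm (X x1) v p q
      = lowCoeff l (p + 1) * v (p + 1) q + (-1) ^ p * (lowCoeff m (q + 1) * v p (q + 1)) := by
  simp [X]

@[simp] theorem verma_X_e_zero (v : V) : verma l m hlm (X xm1) v 0 0 = 0 := by simp [X]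

@[simp] theorem verma_X_e_succ (v : V) (p : ℕ) :
    verma l m hlm (X xm1) v (p + 1) 0 = v p 0 := by simp [X]

theorem verma_X_f_hwVec : verma l m hlm (X x1) hwVec = 0 := by
  ext p q; simp [verma_X_f_apply, hwVec]

/-- Vectors annihilated by `X_α` are annihilated by `I`. -/
theorem verma_mem_I {v : V} (hv : verma l m hlm (X x1) v = 0) {u : U} (hu : u ∈ I) :
    verma l m hlm u v = 0 := by
  induction hu using Submodule.span_induction with
  | mem a ha =>
    rcases ha with rfl | rfl
    · exact hv
    · simp [X_x2, hv]
  | zero => simp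
  | add a b _ _ ha hb => simp [ha, hb]
  | smul c a _ ha => simp [ha]

/-- The singular vectors obtained from the highest weight vector. -/
def lowVec (l m : ℂ) (hlm : ∀ n : ℤ, l + m ≠ n) (k : ℕ) : V :=
  verma l m hlm (lowering 0 ^ k) hwVec

theorem lowVec_zero : lowVec l m hlm 0 = hwVec := by simp [lowVec]

theorem lowVec_succ (k : ℕ) :
    lowVec l m hlm (k + 1) = verma l m hlm (lowering 0) (lowVec l m hlm k) := by
  simp [lowVec, pow_succ']

theorem verma_X_f_lowVec (k : ℕ) : verma l m hlm (X x1) (lowVec l m hlm k) = 0 := by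
  rw [lowVec, ← Module.End.mul_apply, ← map_mul]
  have h1 : lowering 0 ^ k ∈ N := pow_mem (lowering_mem_N 0) k
  exact verma_mem_I verma_X_f_hwVec (h1 _ X_f_mem)

theorem verma_X_h_lowVec (k : ℕ) :
    verma l m hlm (X h) (lowVec l m hlm k) = (l + m + k) • lowVec l m hlm k := by
  induction k with
  | zero =>
    rw [lowVec_zero]
    ext p q
    by_cases hpq : p = 0 ∧ q = 0
    · simp [hpq.1, hpq.2]
    · simp [hwVec, hpq]
  | succ k ih =>
    rw [lowVec_succ, ← Module.End.mul_apply, ← map_mul, X_h_lowering, map_add, map_mul,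
      LinearMap.add_apply, Module.End.mul_apply, ih, map_smul]
    push_cast
    module

/-- The coordinate (p, q) has H-weight l + m + p + q, so an eigenvector of weight l + m + k lives in
degree k. -/
theorem lowVec_support {k p q : ℕ} (hpq : p + q ≠ k) : lowVec l m hlm k p q = 0 := by
  have := congr_fun (congr_fun (verma_X_h_lowVec (hlm := hlm) k) p) q
  simp only [verma_X_h, diag_apply, Pi.smul_apply, smul_eq_mul] at this
  have h2 : ((p + q : ℕ) - (k : ℕ) : ℂ) * lowVec l m hlm k p q = 0 := by
    push_cast; linear_combination this
  exact (mul_eq_zero.1 h2).resolve_left (sub_ne_zero.2 (by exact_mod_cast hpq))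

/-- In the row q = 0 the operator `raiseR` contributes nothing, so a single coordinate of v matters.
The truncated `k - 1` at k = 0 is harmless because `lowCoeff l 0 = 0`. -/
theorem lowering_apply (v : V) (k : ℕ) :
    verma l m hlm (lowering 0) v (k + 1) 0 = v k 0 * (1 - (l + m + k)⁻¹ * (l + k)
      - (l + m + k)⁻¹ * lowCoeff l k
      + 2 * ((l + m + k - 1)⁻¹ * ((l + m + k)⁻¹ * (lowCoeff l (k - 1) * lowCoeff l k)))) := by
  have h2 : verma l m hlm 2 = 2 := map_ofNat _ 2
  rcases k with _ | _ | k
  · simp [lowering, h2, lowCoeff]; ring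
  · simp [lowering, h2, lowCoeff]; ring
  · simp [lowering, h2]; ring_nf

/-- Here l may be an integer: the case l = -j is needed for the reflection. -/
theorem lowVec_ne_zero (hm : ∀ n : ℤ, m ≠ n) (hne : l ≠ m) (k : ℕ) :
    lowVec l m hlm k k 0 ≠ 0 := by
  induction k with
  | zero => simp [lowVec_zero, hwVec]
  | succ k ih =>
    rw [lowVec_succ, lowering_apply]
    refine mul_ne_zero ih ?_
    have h1 (n : ℤ) : l + m + n ≠ 0 := fun h0 => hlm (-n) (by push_cast; linear_combination h0)
    have h3 (n : ℤ) : m + n ≠ 0 := fun h0 => hm (-n) (by push_cast; linear_combination h0)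
    have h4 : l + m + k ≠ 0 := mod_cast h1 k
    have h5 : l + m + k - 1 ≠ 0 := fun h0 => h1 (k - 1) (by push_cast; linear_combination h0)
    obtain ⟨j, rfl | rfl⟩ := Nat.even_or_odd' k
    · have e : lowCoeff l (2 * j - 1) * lowCoeff l (2 * j) = (l + j - 1) * j := by
        rcases j with _ | j
        · simp [lowCoeff]
        · rw [(lowCoeff_even_odd l _).1, show 2 * (j + 1) - 1 = 2 * j + 1 by omega,
            (lowCoeff_even_odd l _).2]
          push_cast; ring
      rw [e, (lowCoeff_even_odd l _).1]
      push_cast at h4 h5 ⊢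
      -- For k = 2j the numerator of the factor is (m + j)(l + m - 1).
      have h6 := mul_ne_zero (h3 j) (h1 (-1))
      intro h0
      apply h6
      field_simp at h0
      push_cast
      linear_combination h0
    · rw [Nat.add_sub_cancel, (lowCoeff_even_odd l _).1, (lowCoeff_even_odd l _).2]
      push_cast at h4 h5 ⊢
      -- For k = 2j + 1 the numerator is (m - l)(l + m + j); this is where l ≠ m enters.
      have h6 := mul_ne_zero (sub_ne_zero.2 hne.symm) (h1 j)
      intro h0
      apply h6
      field_simp at h0
      push_cast
      linear_combination h0

theorem lowVec_rec (k p q : ℕ) :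
    (-1) ^ p * (lowCoeff m (q + 1) * lowVec l m hlm k p (q + 1))
      = -(lowCoeff l (p + 1) * lowVec l m hlm k (p + 1) q) := by
  have := congr_fun (congr_fun (verma_X_f_lowVec (hlm := hlm) k) p) q
  rw [verma_X_f_apply, Pi.zero_apply, Pi.zero_apply] at this
  linear_combination this

theorem lowCoeff_ne_zero (hm : ∀ n : ℤ, m ≠ n) (q : ℕ) : lowCoeff m (q + 1) ≠ 0 := by
  obtain ⟨j, rfl | rfl⟩ := Nat.even_or_odd' q
  · rw [(lowCoeff_even_odd m _).2]
    exact fun h0 => hm (-j) (by push_cast; linear_combination h0)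
  · rw [show 2 * j + 1 + 1 = 2 * (j + 1) by ring, (lowCoeff_even_odd m _).1]
    exact Nat.cast_ne_zero.2 (by omega)

/-- Annihilation by X_α links neighbours on an antidiagonal, so nonvanishing spreads from the row q
= 0 when no coefficient of l vanishes. -/
theorem lowVec_ne_zero' (hl : ∀ n : ℤ, l ≠ n) (hm : ∀ n : ℤ, m ≠ n) (hne : l ≠ m) (p q : ℕ) :
    lowVec l m hlm (p + q) p q ≠ 0 := by
  induction q generalizing p with
  | zero => exact lowVec_ne_zero hm hne p
  | succ q ih =>
    intro h0
    have h1 := lowVec_rec (hlm := hlm) (p + (q + 1)) p q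
    rw [h0, mul_zero, mul_zero, eq_comm, neg_eq_zero] at h1
    have h2 := ih (p + 1)
    rw [show p + 1 + q = p + (q + 1) by ring] at h2
    exact mul_ne_zero (lowCoeff_ne_zero hl p) h2 h1

end

/-- For `l = -j`, the singular vector of weight `m + j + 1` generates a Verma submodule. -/
theorem lowVec_reflect (j : ℕ) {m : ℂ} (hm : ∀ n : ℤ, m ≠ n) (hlm : ∀ n : ℤ, (-j : ℂ) + m ≠ n) :
    lowVec (-j) m hlm (2 * j + 1)
      = lowVec (-j) m hlm (2 * j + 1) (2 * j + 1) 0 • shiftV j hwVec := by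
  have key (q p : ℕ) : lowVec (-j) m hlm (2 * j + 1) p (q + 1) = 0 := by
    induction q generalizing p with
    | zero =>
      have h1 := lowVec_rec (hlm := hlm) (2 * j + 1) p 0
      have h2 : lowCoeff (-j) (p + 1) * lowVec (-j) m hlm (2 * j + 1) (p + 1) 0 = 0 := by
        -- The only possibly nonzero entry in row 0 has p + 1 = 2j + 1, and there the coefficient
        -- vanishes for l = -j. So row 1 is zero, and the recursion kills all later rows.
        by_cases hp : p = 2 * j
        · rw [hp, (lowCoeff_even_odd _ _).2]; simp
        · rw [lowVec_support (by omega), mul_zero]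
      rw [h2, neg_zero] at h1
      simpa [lowCoeff_ne_zero hm] using h1
    | succ q ih =>
      have h1 := lowVec_rec (hlm := hlm) (2 * j + 1) p (q + 1)
      rw [ih, mul_zero, neg_zero] at h1
      simpa [lowCoeff_ne_zero hm] using h1
  ext p q
  rw [Pi.smul_apply, Pi.smul_apply, smul_eq_mul]
  rcases q with _ | q
  · rcases eq_or_ne p (2 * j + 1) with rfl | hp
    · have := shiftV_add j 0 hwVec 0
      rw [zero_add] at this
      simp [this, hwVec]
    · rw [lowVec_support (by omega)]
      rcases lt_or_ge p (2 * j + 1) with hp' | hp'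
      · simp [shiftV_lt hp']
      · obtain ⟨r, rfl⟩ := Nat.exists_eq_add_of_le' hp'
        have : r ≠ 0 := by rintro rfl; simp at hp
        simp [shiftV_add, hwVec, this]
  · rw [key]
    rcases lt_or_ge p (2 * j + 1) with hp' | hp'
    · simp [shiftV_lt hp']
    · obtain ⟨r, rfl⟩ := Nat.exists_eq_add_of_le' hp'
      simp [shiftV_add, hwVec]

/-! ### Polynomials in the Cartan elements -/

/-- The embedding of `ℂ[h ⊗ 1, 1 ⊗ h]` into `U`. -/
def hPoly : MvPolynomial (Fin 2) ℂ →ₐ[ℂ] U :=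
  AddMonoidAlgebra.lift ℂ U (Fin 2 →₀ ℕ)
    { toFun := fun s => el 0 h ^ (s.toAdd 0) * el 1 h ^ (s.toAdd 1)
      map_one' := by simp
      map_mul' := fun s t => by
        have hc : Commute (el 0 h) (el 1 h) := cross_h (zero_ne_one' (Fin 2)) h
        simp only [toAdd_mul, Finsupp.add_apply, pow_add]
        rw [mul_assoc, mul_assoc, ← mul_assoc (el 0 h ^ (Multiplicative.toAdd t 0)),
          (hc.pow_pow _ _).eq]
        simp only [mul_assoc] }

theorem hPoly_X (i : Fin 2) : hPoly (MvPolynomial.X i) = el i h := by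
  rw [hPoly, MvPolynomial.X, ← MvPolynomial.single_eq_monomial, AddMonoidAlgebra.lift_single]
  fin_cases i <;> simp

theorem exists_mul_hPoly {u : U} (hu : ∀ i, ∃ Q, u * el i h = hPoly Q * u)
    (P : MvPolynomial (Fin 2) ℂ) : ∃ Q, u * hPoly P = hPoly Q * u := by
  induction P using MvPolynomial.induction_on with
  | C a =>
    refine ⟨MvPolynomial.C a, ?_⟩
    rw [← MvPolynomial.algebraMap_eq, AlgHom.commutes, Algebra.commutes]
  | add p q hp hq =>
    obtain ⟨p', hp⟩ := hp
    obtain ⟨q', hq⟩ := hq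
    exact ⟨p' + q', by rw [map_add, mul_add, hp, hq, map_add, add_mul]⟩
  | mul_X p i hp =>
    obtain ⟨p', hp⟩ := hp
    obtain ⟨q', hq⟩ := hu i
    exact ⟨p' * q', by rw [map_mul, hPoly_X, ← mul_assoc, hp, mul_assoc, hq, map_mul, mul_assoc]⟩

theorem exists_f_mul_hPoly (i : Fin 2) (P : MvPolynomial (Fin 2) ℂ) :
    ∃ Q, el i x1 * hPoly P = hPoly Q * el i x1 := by
  refine exists_mul_hPoly (fun j => ?_) P
  by_cases hij : i = j
  · subst hij
    exact ⟨MvPolynomial.X i + 1, by rw [rel_x1_h, map_add, hPoly_X, map_one, add_mul, one_mul]⟩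
  · exact ⟨MvPolynomial.X j, by rw [hPoly_X, cross_h (Ne.symm hij)]⟩

theorem exists_hPoly_mul_e_pow (i j : Fin 2) (a : ℕ) :
    ∃ Q, el i h * el j xm1 ^ a = el j xm1 ^ a * hPoly Q ∧ Q = MvPolynomial.X i +
      MvPolynomial.C (if i = j then (a : ℂ) else 0) := by
  refine ⟨_, ?_, rfl⟩
  rw [map_add, hPoly_X, ← MvPolynomial.algebraMap_eq, AlgHom.commutes]
  induction a with
  | zero => simp
  | succ a ih =>
    rw [pow_succ, ← mul_assoc, ih, mul_assoc, mul_assoc]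
    congr 1
    by_cases hij : i = j
    · subst hij
      simp only [if_true, add_mul, mul_add, rel_h_e, Nat.cast_succ, map_add, map_one, mul_one,
        Algebra.commutes]
      abel
    · simp [hij, cross_h hij]

/-! ### Normal ordered elements -/

/-- A normal ordered element of `U`. -/
def normalWord (t : ℕ × ℕ × ℕ) (P : MvPolynomial (Fin 2) ℂ) : U :=
  el 0 xm1 ^ t.1 * (el 1 xm1 ^ t.2.1 * (hPoly P * el 1 x1 ^ t.2.2))

/-- Linear combinations of normal ordered elements. -/
def normalForm : ((ℕ × ℕ × ℕ) →₀ MvPolynomial (Fin 2) ℂ) →ₗ[ℂ] U :=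
  Finsupp.lsum ℂ fun t =>
    LinearMap.mulLeft ℂ (el 0 xm1 ^ t.1) ∘ₗ LinearMap.mulLeft ℂ (el 1 xm1 ^ t.2.1) ∘ₗ
      LinearMap.mulRight ℂ (el 1 x1 ^ t.2.2) ∘ₗ hPoly.toLinearMap

theorem normalForm_apply (c : (ℕ × ℕ × ℕ) →₀ MvPolynomial (Fin 2) ℂ) :
    normalForm c = c.sum normalWord := by
  simp [normalForm, Finsupp.lsum_apply]; rfl

theorem normalForm_single (t : ℕ × ℕ × ℕ) (P : MvPolynomial (Fin 2) ℂ) :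
    normalForm (Finsupp.single t P) = normalWord t P := by
  simp [normalForm, normalWord]

/-- The elements which are normal ordered modulo `I`, without denominators. -/
def normalOrdered : Submodule ℂ U := LinearMap.range normalForm ⊔ I.restrictScalars ℂ

theorem normalWord_mem (t : ℕ × ℕ × ℕ) (P : MvPolynomial (Fin 2) ℂ) :
    normalWord t P ∈ normalOrdered :=
  Submodule.mem_sup_left ⟨_, normalForm_single t P⟩

theorem mem_normalOrdered_of_mem_I {u : U} (hu : u ∈ I) : u ∈ normalOrdered :=
  Submodule.mem_sup_right hu

theorem mul_mem_normalOrdered {x : U} (hx : ∀ t P, x * normalWord t P ∈ normalOrdered) {u : U}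
    (hu : u ∈ normalOrdered) : x * u ∈ normalOrdered := by
  obtain ⟨_, ⟨c, rfl⟩, v, hv, rfl⟩ := Submodule.mem_sup.1 hu
  rw [mul_add]
  refine add_mem ?_ (mem_normalOrdered_of_mem_I (I.mul_mem_left _ hv))
  rw [normalForm_apply, Finsupp.sum, Finset.mul_sum]
  exact sum_mem fun t _ => hx t _

theorem e_mul_mem (i : Fin 2) {u : U} (hu : u ∈ normalOrdered) :
    el i xm1 * u ∈ normalOrdered := by
  refine mul_mem_normalOrdered (fun ⟨a, b, k⟩ P => ?_) hu
  fin_cases i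
  · have : el 0 xm1 * normalWord (a, b, k) P = normalWord (a + 1, b, k) P := by
      simp [normalWord, pow_succ', mul_assoc]
    exact this ▸ normalWord_mem _ _
  · have h1 : el 1 xm1 * el 0 xm1 ^ a = (-1 : ℂ) ^ a • (el 0 xm1 ^ a * el 1 xm1) := by
      induction a with
      | zero => simp
      | succ a ih =>
        rw [pow_succ, ← mul_assoc, ih, smul_mul_assoc, mul_assoc, cross_e_e (one_ne_zero' (Fin 2))]
        simp [pow_succ, mul_assoc]
    have : el 1 xm1 * normalWord (a, b, k) P = (-1 : ℂ) ^ a • normalWord (a, b + 1, k) P := by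
      simp only [normalWord]
      rw [← mul_assoc, h1, smul_mul_assoc, pow_succ', mul_assoc, mul_assoc]
    exact this ▸ Submodule.smul_mem _ _ (normalWord_mem _ _)

theorem h_mul_mem (i : Fin 2) {u : U} (hu : u ∈ normalOrdered) :
    el i h * u ∈ normalOrdered := by
  refine mul_mem_normalOrdered (fun ⟨a, b, k⟩ P => ?_) hu
  obtain ⟨Q, hQ, hQ'⟩ := exists_hPoly_mul_e_pow i 0 a
  obtain ⟨Q', hQ1, hQ1'⟩ := exists_hPoly_mul_e_pow i 1 b
  have e : hPoly Q * el 1 xm1 ^ b = el 1 xm1 ^ b * hPoly (Q' +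
      MvPolynomial.C (if i = 0 then (a : ℂ) else 0)) := by
    rw [hQ', map_add, hPoly_X, add_mul, hQ1, map_add, mul_add, ← MvPolynomial.algebraMap_eq,
      AlgHom.commutes, Algebra.commutes]
  have : el i h * normalWord (a, b, k) P = normalWord (a, b, k) ((Q' +
      MvPolynomial.C (if i = 0 then (a : ℂ) else 0)) * P) := by
    simp only [normalWord]
    rw [← mul_assoc, hQ, mul_assoc, ← mul_assoc (hPoly Q), e, map_mul hPoly]
    simp only [mul_assoc]
  exact this ▸ normalWord_mem _ _

theorem e_pow_mul_mem (j : Fin 2) (a : ℕ) {u : U} (hu : u ∈ normalOrdered) :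
    el j xm1 ^ a * u ∈ normalOrdered := by
  induction a with
  | zero => simpa using hu
  | succ a ih => rw [pow_succ', mul_assoc]; exact e_mul_mem j ih

theorem f_mul_e_pow_mul_mem (i j : Fin 2) (a : ℕ) {u : U} (hu : u ∈ normalOrdered)
    (hfu : el i x1 * u ∈ normalOrdered) : el i x1 * (el j xm1 ^ a * u) ∈ normalOrdered := by
  induction a with
  | zero => simpa using hfu
  | succ a ih =>
    rw [pow_succ', mul_assoc, ← mul_assoc]
    by_cases hij : i = j
    · subst hij
      rw [rel_x1_xm1, sub_mul, mul_assoc]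
      exact sub_mem (h_mul_mem i (e_pow_mul_mem i a hu)) (e_mul_mem i ih)
    · rw [cross_f_e hij, neg_mul, mul_assoc]
      exact neg_mem (e_mul_mem j ih)

theorem hPoly_mul_mem (P : MvPolynomial (Fin 2) ℂ) {u : U} (hu : u ∈ normalOrdered) :
    hPoly P * u ∈ normalOrdered := by
  induction P using MvPolynomial.induction_on generalizing u with
  | C a =>
    rw [← MvPolynomial.algebraMap_eq, AlgHom.commutes, ← Algebra.smul_def]
    exact Submodule.smul_mem _ _ hu
  | add p q hp hq => rw [map_add, add_mul]; exact add_mem (hp hu) (hq hu)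
  | mul_X p i hp => rw [map_mul, hPoly_X, mul_assoc]; exact hp (h_mul_mem i hu)

/-- Modulo I one has x_α ⊗ 1 = -1 ⊗ x_α. Hence normal ordered words need no power of x_α ⊗ 1. -/
theorem exists_f_mul_f_pow (k : ℕ) :
    ∃ c : ℂ, el 0 x1 * el 1 x1 ^ k - c • el 1 x1 ^ (k + 1) ∈ I := by
  induction k with
  | zero =>
    refine ⟨-1, ?_⟩
    have : el 0 x1 * el 1 x1 ^ 0 - (-1 : ℂ) • el 1 x1 ^ (0 + 1) = X x1 := by simp [X]
    exact this ▸ X_f_mem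
  | succ k ih =>
    obtain ⟨c, hc⟩ := ih
    refine ⟨-c, ?_⟩
    have : el 0 x1 * el 1 x1 ^ (k + 1) - (-c) • el 1 x1 ^ (k + 1 + 1)
        = -el 1 x1 * (el 0 x1 * el 1 x1 ^ k - c • el 1 x1 ^ (k + 1)) := by
      rw [pow_succ', ← mul_assoc, cross_f_f (zero_ne_one' (Fin 2)), pow_succ' _ (k + 1), mul_sub,
        mul_smul_comm, pow_succ' _ k]
      simp [mul_assoc]
    exact this ▸ I.mul_mem_left _ hc

theorem f_mul_mem (i : Fin 2) {u : U} (hu : u ∈ normalOrdered) :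
    el i x1 * u ∈ normalOrdered := by
  refine mul_mem_normalOrdered (fun ⟨a, b, k⟩ P => ?_) hu
  have h0 (Q : MvPolynomial (Fin 2) ℂ) (k : ℕ) : hPoly Q * el 1 x1 ^ k ∈ normalOrdered := by
    have := normalWord_mem (0, 0, k) Q
    simpa [normalWord] using this
  refine f_mul_e_pow_mul_mem i 0 a (e_pow_mul_mem 1 b (h0 _ _))
    (f_mul_e_pow_mul_mem i 1 b (h0 _ _) ?_)
  obtain ⟨Q, hQ⟩ := exists_f_mul_hPoly i P
  rw [← mul_assoc, hQ, mul_assoc]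
  fin_cases i
  · obtain ⟨c, hc⟩ := exists_f_mul_f_pow k
    simp only [Fin.zero_eta]
    rw [← sub_add_cancel (el 0 x1 * el 1 x1 ^ k) (c • el 1 x1 ^ (k + 1)), mul_add, mul_smul_comm]
    exact add_mem (mem_normalOrdered_of_mem_I (I.mul_mem_left _ hc))
      (Submodule.smul_mem _ _ (h0 _ _))
  · rw [Fin.mk_one, ← pow_succ']
    exact h0 _ _

/-! ### Denominators -/

/-- The product of the polynomials `H - n`. -/
def denom (D : List ℤ) : MvPolynomial (Fin 2) ℂ :=
  (D.map fun n : ℤ => MvPolynomial.X 0 + MvPolynomial.X 1 - MvPolynomial.C (n : ℂ)).prod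

theorem denom_cons (n : ℤ) (D : List ℤ) : denom (n :: D)
    = (MvPolynomial.X 0 + MvPolynomial.X 1 - MvPolynomial.C (n : ℂ)) * denom D := by
  simp [denom]

theorem denom_append (D D' : List ℤ) : denom (D ++ D') = denom D * denom D' := by
  simp [denom]

theorem hPoly_linear (n : ℤ) :
    hPoly (MvPolynomial.X 0 + MvPolynomial.X 1 - MvPolynomial.C (n : ℂ)) = shift n := by
  rw [map_sub, map_add, hPoly_X, hPoly_X, ← MvPolynomial.algebraMap_eq, AlgHom.commutes]; rfl

theorem hPoly_denom_mul_of_weight {a : U} {k : ℤ} (ha : X h * a = a * X h + (k : ℂ) • a)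
    (D : List ℤ) : hPoly (denom (D.map (· + k))) * a = a * hPoly (denom D) := by
  induction D with
  | nil => simp [denom]
  | cons n D ih =>
    rw [List.map_cons, denom_cons, denom_cons, map_mul, map_mul, hPoly_linear, hPoly_linear,
      mul_assoc, ih, ← mul_assoc, shift_mul_of_weight ha, add_sub_cancel_right, mul_assoc]

theorem hPoly_denom_isUnit (D : List ℤ) : IsUnit (hPoly (denom D)) := by
  induction D with
  | nil => simp [denom]
  | cons n D ih =>
    rw [denom_cons, map_mul, hPoly_linear]
    exact IsUnit.mul ⟨⟨_, _, shift_mul_hinv n, hinv_mul_shift n⟩, rfl⟩ ih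

/-- Denominators can be cleared on the left because H - n moves past a weight vector at the cost of
a shift in n. -/
theorem exists_denom_mul_mem (u : U) : ∃ D, hPoly (denom D) * u ∈ normalOrdered := by
  -- The elements admitting a denominator are stable under left multiplication by all of U; the
  -- claim then follows from the case of 1.
  have key (x : U) : ∀ u, (∃ D, hPoly (denom D) * u ∈ normalOrdered) →
      ∃ D, hPoly (denom D) * (x * u) ∈ normalOrdered := by
    induction x using U_induction with
    | halg c =>
      rintro u ⟨D, hD⟩
      refine ⟨D, ?_⟩
      rw [← Algebra.smul_def, mul_smul_comm]
      exact Submodule.smul_mem _ _ hD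
    | he i =>
      rintro u ⟨D, hD⟩
      refine ⟨D.map (· + 1), ?_⟩
      rw [← mul_assoc, hPoly_denom_mul_of_weight (by rw [X_h_e]; simp), mul_assoc]
      exact e_mul_mem i hD
    | hf i =>
      rintro u ⟨D, hD⟩
      refine ⟨D.map (· + (-1)), ?_⟩
      rw [← mul_assoc, hPoly_denom_mul_of_weight (by rw [X_h_f]; simp; abel), mul_assoc]
      exact f_mul_mem i hD
    | hinv n =>
      rintro u ⟨D, hD⟩
      refine ⟨n :: D, ?_⟩
      rw [denom_cons, mul_comm, map_mul, hPoly_linear, mul_assoc, ← mul_assoc (shift n),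
        shift_mul_hinv, one_mul]
      exact hD
    | hadd x y hx hy =>
      intro u hu
      obtain ⟨D, hD⟩ := hx u hu
      obtain ⟨D', hD'⟩ := hy u hu
      refine ⟨D ++ D', ?_⟩
      rw [add_mul, mul_add, denom_append]
      nth_rewrite 1 [mul_comm]
      rw [map_mul, map_mul, mul_assoc, mul_assoc]
      exact add_mem (hPoly_mul_mem _ hD) (hPoly_mul_mem _ hD')
    | hmul x y hx hy => intro u hu; rw [mul_assoc]; exact hx _ (hy _ hu)
  have h1 : (1 : U) ∈ normalOrdered := by
    simpa [normalWord] using normalWord_mem (0, 0, 0) 1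
  simpa using key u 1 ⟨[], by simpa [denom] using h1⟩

/-! ### The action of normal ordered elements -/

section

variable {l m : ℂ} {hlm : ∀ n : ℤ, l + m ≠ n}

theorem verma_hPoly_apply (P : MvPolynomial (Fin 2) ℂ) (v : V) (p q : ℕ) :
    verma l m hlm (hPoly P) v p q = MvPolynomial.eval ![l + p, m + q] P * v p q := by
  induction P using MvPolynomial.induction_on generalizing v with
  | C a => rw [← MvPolynomial.algebraMap_eq, AlgHom.commutes, AlgHom.commutes]; simp
  | add P Q hP hQ => simp [hP, hQ, add_mul]
  | mul_X P i hP =>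
    rw [map_mul, hPoly_X, map_mul, Module.End.mul_apply, hP, map_mul, MvPolynomial.eval_X]
    fin_cases i <;> simp [mul_assoc]

theorem raiseR_pow_hwVec (b p q : ℕ) :
    (raiseR ^ b) hwVec p q = if p = 0 ∧ q = b then 1 else 0 := by
  induction b generalizing p q with
  | zero => rfl
  | succ b ih =>
    rw [pow_succ', Module.End.mul_apply]
    rcases q with _ | q
    · simp
    · rw [raiseR_succ, ih]
      by_cases hp : p = 0 <;> simp [hp]

theorem raise_pow_hwVec (a b p q : ℕ) :
    (raiseL ^ a) ((raiseR ^ b) hwVec) p q = if p = a ∧ q = b then 1 else 0 := by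
  induction a generalizing p q with
  | zero => exact raiseR_pow_hwVec b p q
  | succ a ih =>
    rw [pow_succ', Module.End.mul_apply]
    rcases p with _ | p
    · simp
    · rw [raiseL_succ, ih]; simp

theorem verma_normalWord_apply {v : V} {k : ℕ} {c : ℂ}
    (hv : verma l m hlm (el 1 x1 ^ k) v = c • hwVec) (a b : ℕ) (P : MvPolynomial (Fin 2) ℂ)
    (p q : ℕ) : verma l m hlm (normalWord (a, b, k) P) v p q
      = if p = a ∧ q = b then c * MvPolynomial.eval ![l, m] P else 0 := by
  have h1 : verma l m hlm (hPoly P) hwVec = MvPolynomial.eval ![l, m] P • hwVec := by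
    ext p q
    rw [verma_hPoly_apply, Pi.smul_apply, Pi.smul_apply, smul_eq_mul, hwVec]
    split_ifs with hpq
    · simp [hpq.1, hpq.2]
    · simp
  simp only [normalWord, map_mul, Module.End.mul_apply, hv, map_smul, h1, Pi.smul_apply, smul_eq_mul]
  simp only [map_pow, verma_e_zero, verma_e_one, raise_pow_hwVec]
  split_ifs <;> simp

/-- A vector on which only the k-th of the occurring powers of 1 ⊗ x_α is nonzero reads off the
coefficients with last index k. Restricting the hypothesis to powers that occur in C makes induction
on k possible. -/
theorem verma_normalForm_apply {v : V} {k : ℕ} {c : ℂ}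
    (C : (ℕ × ℕ × ℕ) →₀ MvPolynomial (Fin 2) ℂ)
    (hv : ∀ a b j, C (a, b, j) ≠ 0 →
      verma l m hlm (el 1 x1 ^ j) v = (if j = k then c else 0) • hwVec) (p q : ℕ) :
    verma l m hlm (normalForm C) v p q = c * MvPolynomial.eval ![l, m] (C (p, q, k)) := by
  rw [normalForm_apply, Finsupp.sum, map_sum, LinearMap.sum_apply, Finset.sum_apply,
    Finset.sum_apply]
  rw [Finset.sum_eq_single (p, q, k)]
  · by_cases h0 : C (p, q, k) = 0
    · simp [h0, normalWord]
    · rw [verma_normalWord_apply (hv p q k h0)]; simp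
  · rintro ⟨a, b, j⟩ hC hne
    rw [verma_normalWord_apply (hv a b j (Finsupp.mem_support_iff.1 hC))]
    by_cases hj : j = k
    · rw [if_neg]
      rintro ⟨rfl, rfl⟩
      exact hne (by rw [hj])
    · simp [hj]
  · intro hC
    simp [Finsupp.notMem_support_iff.1 hC, normalWord]

theorem exists_lowerR_pow (hm : ∀ n : ℤ, m ≠ n) (k : ℕ) : ∃ c : ℕ → ℕ → ℂ, (∀ p q, c p q ≠ 0) ∧
    ∀ v p q, (lowerR m ^ k) v p q = c p q * v p (q + k) := by
  induction k with
  | zero => exact ⟨fun _ _ => 1, by simp, by simp⟩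
  | succ k ih =>
    obtain ⟨c, hc, hk⟩ := ih
    refine ⟨fun p q => (-1) ^ p * (lowCoeff m (q + 1) * c p (q + 1)), fun p q => ?_, fun v p q => ?_⟩
    · exact mul_ne_zero (by simp) (mul_ne_zero (lowCoeff_ne_zero hm q) (hc _ _))
    · rw [pow_succ', Module.End.mul_apply, lowerR_apply, hk]
      ring_nf

/-- The k-th power of 1 ⊗ x_α brings degree k to degree 0 with a factor proportional to the entry
(0, k), which is nonzero; larger powers vanish for degree reasons. -/
theorem exists_f_pow_lowVec (hl : ∀ n : ℤ, l ≠ n) (hm : ∀ n : ℤ, m ≠ n) (hne : l ≠ m) (k : ℕ) :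
    ∃ c : ℂ, c ≠ 0 ∧ ∀ j, k ≤ j →
      verma l m hlm (el 1 x1 ^ j) (lowVec l m hlm k) = (if j = k then c else 0) • hwVec := by
  obtain ⟨c, hc, hk⟩ := exists_lowerR_pow hm k
  refine ⟨c 0 0 * lowVec l m hlm k 0 k,
    mul_ne_zero (hc _ _) (by simpa using lowVec_ne_zero' (hlm := hlm) hl hm hne 0 k), fun j hj => ?_⟩
  rw [map_pow, verma_f_one]
  split_ifs with hjk
  · subst hjk
    ext p q
    rw [hk, Pi.smul_apply, Pi.smul_apply, smul_eq_mul, hwVec]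
    split_ifs with hpq
    · simp [hpq.1, hpq.2]
    · rw [lowVec_support (by omega), mul_zero, mul_zero]
  · obtain ⟨c, hc, hk⟩ := exists_lowerR_pow hm j
    ext p q
    rw [hk, lowVec_support (by omega)]
    simp

theorem f_pow_hwVec (j : ℕ) :
    verma l m hlm (el 1 x1 ^ j) hwVec = (if j = 0 then 1 else 0 : ℂ) • hwVec := by
  rcases j with _ | j
  · simp
  · have : lowerR m hwVec = 0 := by ext p q; simp [hwVec]
    rw [map_pow, verma_f_one, pow_succ, Module.End.mul_apply, this]
    simp

end

/-! ### Generic parameters and detection of I by singular vectors -/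

theorem add_ne_int {l m : ℂ} (hl : 0 ≤ l.im) (hm : 0 < m.im) (n : ℤ) : l + m ≠ n := fun h0 => by
  have := congr_arg Complex.im h0
  simp at this
  linarith

theorem ne_int {m : ℂ} (hm : 0 < m.im) (n : ℤ) : m ≠ n := fun h0 => by
  simp [h0] at hm

/-- A polynomial is determined by its values on the points off the diagonal with coordinates in
the upper half plane. -/
theorem eq_zero_of_eval {P : MvPolynomial (Fin 2) ℂ}
    (hP : ∀ l m : ℂ, 0 < l.im → 0 < m.im → l ≠ m → MvPolynomial.eval ![l, m] P = 0) : P = 0 := by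
  -- Opposite signs of the real parts force l ≠ m on a product of two infinite sets.
  refine MvPolynomial.funext_set ![{z : ℂ | 0 < z.im ∧ z.re < 0}, {z : ℂ | 0 < z.im ∧ 0 < z.re}]
    (fun i => ?_) fun x hx => ?_
  · fin_cases i
    · refine Set.infinite_of_injective_forall_mem (f := fun n : ℕ => (⟨-(n + 1), 1⟩ : ℂ))
        (fun a b hab => ?_) fun n => ⟨by simp, ?_⟩
      · simpa using congr_arg Complex.re hab
      · change -((n : ℝ) + 1) < 0
        have := n.cast_nonneg (α := ℝ)
        linarith
    · refine Set.infinite_of_injective_forall_mem (f := fun n : ℕ => (⟨n + 1, 1⟩ : ℂ))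
        (fun a b hab => ?_) fun n => ⟨by simp, ?_⟩
      · simpa using congr_arg Complex.re hab
      · change 0 < (n : ℝ) + 1
        positivity
  · have h0 := hx 0 trivial
    have h1 := hx 1 trivial
    have e : x = ![x 0, x 1] := by ext i; fin_cases i <;> rfl
    rw [e, map_zero]
    exact hP _ _ h0.1 h1.1 fun h2 => by
      have h3 := h0.2
      rw [h2] at h3
      exact lt_asymm h3 h1.2

/-- An element of `U` which annihilates the singular vectors of all generic tensor products of
Verma modules lies in `I`. -/
theorem mem_I_of_verma {u : U} (hu : ∀ l m : ℂ, 0 < l.im → 0 < m.im → l ≠ m →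
    ∀ hlm k, verma l m hlm u (lowVec l m hlm k) = 0) : u ∈ I := by
  obtain ⟨D, hD⟩ := exists_denom_mul_mem u
  obtain ⟨_, ⟨c, rfl⟩, v, hv, huv⟩ := Submodule.mem_sup.1 hD
  -- Triangularity: on `lowVec k`, powers above k vanish, and powers below k no longer occur by
  -- induction, so the k-th coefficients are isolated.
  have hc (k : ℕ) : ∀ p q, c (p, q, k) = 0 := by
    induction k using Nat.strong_induction_on with
    | _ k ih =>
      intro p q
      refine eq_zero_of_eval fun l m hl hm hne => ?_
      have hlm := add_ne_int hl.le hm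
      obtain ⟨z, hz, hj⟩ := exists_f_pow_lowVec (hlm := hlm) (ne_int hl) (ne_int hm) hne k
      have h1 := verma_normalForm_apply c (fun a b j h0 => hj j (not_lt.1 fun hjk =>
        h0 (ih j hjk a b))) p q
      have h2 : verma l m hlm (normalForm c) (lowVec l m hlm k) = 0 := by
        have h3 := congr_arg (fun x => verma l m hlm x (lowVec l m hlm k)) huv
        simpa [verma_mem_I (verma_X_f_lowVec k) hv, hu l m hl hm hne] using h3
      rw [h2] at h1
      exact (mul_eq_zero.1 h1.symm).resolve_left hz
  have hc0 : c = 0 := Finsupp.ext fun ⟨p, q, k⟩ => hc k p q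
  rw [hc0, map_zero, zero_add] at huv
  obtain ⟨d, hd⟩ := hPoly_denom_isUnit D
  rw [← hd] at huv
  have : u = (↑d⁻¹ : U) * v := by rw [huv, Units.inv_mul_cancel_left]
  rw [this]
  exact I.mul_mem_left _ hv

/-- The highest weight coefficient of the action of an element of `U` is a rational function. -/
theorem exists_denom_mul_eq_eval (u : U) : ∃ D P, ∀ l m hlm,
    MvPolynomial.eval ![l, m] (denom D) * verma l m hlm u hwVec 0 0
      = MvPolynomial.eval ![l, m] P := by
  obtain ⟨D, hD⟩ := exists_denom_mul_mem u
  obtain ⟨_, ⟨c, rfl⟩, v, hv, huv⟩ := Submodule.mem_sup.1 hD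
  -- On the highest weight vector only words without x_α survive, and the entry (0, 0) excludes
  -- powers of x_{-α}.
  refine ⟨D, c (0, 0, 0), fun l m hlm => ?_⟩
  have h1 := verma_normalForm_apply (hlm := hlm) c (fun a b j _ => f_pow_hwVec j) 0 0
  have h2 := verma_hPoly_apply (hlm := hlm) (denom D) (verma l m hlm u hwVec) 0 0
  rw [← Module.End.mul_apply, ← map_mul, ← huv, map_add, LinearMap.add_apply,
    verma_mem_I verma_X_f_hwVec hv, add_zero, h1] at h2
  simpa using h2.symm

/-! ### Cancellation of denominators -/

/-- The reflection `l ↦ 1 - l` on functions of `l` and `m`. -/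
def reflect : MvPolynomial (Fin 2) ℂ →ₐ[ℂ] MvPolynomial (Fin 2) ℂ :=
  MvPolynomial.aeval ![1 - MvPolynomial.X 0, MvPolynomial.X 1]

theorem eval_reflect (P : MvPolynomial (Fin 2) ℂ) (l m : ℂ) :
    MvPolynomial.eval ![l, m] (reflect P) = MvPolynomial.eval ![1 - l, m] P := by
  induction P using MvPolynomial.induction_on with
  | C a => rw [← MvPolynomial.algebraMap_eq, AlgHom.commutes]; simp
  | add P Q hP hQ => simp [hP, hQ]
  | mul_X P i hP =>
    rw [map_mul, map_mul, hP, map_mul]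
    fin_cases i <;> simp [reflect]

theorem eval_denom_ne_zero {D : List ℤ} {l m : ℂ} (hlm : ∀ n : ℤ, l + m ≠ n) :
    MvPolynomial.eval ![l, m] (denom D) ≠ 0 := by
  induction D with
  | nil => simp [denom]
  | cons n D ih =>
    rw [denom_cons, map_mul]
    refine mul_ne_zero ?_ ih
    simpa [sub_eq_zero] using hlm n

/-- Modulo X 0 + X 1 - n, every polynomial equals its substitution X 1 ↦ n - X 0, which vanishes
here by density. -/
theorem linear_dvd_of_eval {n : ℤ} {P : MvPolynomial (Fin 2) ℂ}
    (hP : ∀ l : ℂ, 0 < l.im → MvPolynomial.eval ![l, n - l] P = 0) :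
    (MvPolynomial.X 0 + MvPolynomial.X 1 - MvPolynomial.C (n : ℂ)) ∣ P := by
  set T : MvPolynomial (Fin 2) ℂ →ₐ[ℂ] MvPolynomial (Fin 2) ℂ :=
    MvPolynomial.aeval ![MvPolynomial.X 0, MvPolynomial.C (n : ℂ) - MvPolynomial.X 0] with hT
  have h1 (P : MvPolynomial (Fin 2) ℂ) :
      (MvPolynomial.X 0 + MvPolynomial.X 1 - MvPolynomial.C (n : ℂ)) ∣ P - T P := by
    induction P using MvPolynomial.induction_on with
    | C a => rw [← MvPolynomial.algebraMap_eq, AlgHom.commutes]; simp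
    | add P Q hP hQ =>
      rw [map_add, add_sub_add_comm]; exact dvd_add hP hQ
    | mul_X P i hP =>
      have e : P * MvPolynomial.X i - T (P * MvPolynomial.X i)
          = (P - T P) * MvPolynomial.X i + T P * (MvPolynomial.X i - T (MvPolynomial.X i)) := by
        rw [map_mul]; ring
      rw [e]
      refine dvd_add (Dvd.dvd.mul_right hP _) (Dvd.dvd.mul_left ?_ _)
      fin_cases i
      · simp [hT]
      · simp only [hT, Fin.mk_one, MvPolynomial.aeval_X, Matrix.cons_val_one]
        exact ⟨1, by simp; ring⟩
  have h2 (P : MvPolynomial (Fin 2) ℂ) (l m : ℂ) :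
      MvPolynomial.eval ![l, m] (T P) = MvPolynomial.eval ![l, n - l] P := by
    induction P using MvPolynomial.induction_on with
    | C a => rw [← MvPolynomial.algebraMap_eq, AlgHom.commutes]; simp
    | add P Q hP hQ => simp [hP, hQ]
    | mul_X P i hP =>
      rw [map_mul, map_mul, hP, map_mul]
      fin_cases i <;> simp [hT]
  have h3 : T P = 0 := eq_zero_of_eval fun l m hl _ _ => by rw [h2, hP l hl]
  simpa [h3] using h1 P

theorem linear_ne_zero (n : ℤ) :
    (MvPolynomial.X 0 + MvPolynomial.X 1 - MvPolynomial.C (n : ℂ) : MvPolynomial (Fin 2) ℂ) ≠ 0 := by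
  intro h0
  have := congr_arg (MvPolynomial.eval ![(n : ℂ), 1]) h0
  simp at this

theorem reflect_reflect (P : MvPolynomial (Fin 2) ℂ) : reflect (reflect P) = P := by
  refine sub_eq_zero.1 (eq_zero_of_eval fun l m _ _ _ => ?_)
  simp [eval_reflect]

/-- The linear factors cancel one at a time: on the line l + m = n the right side vanishes, while
the reflected denominator does not where l has positive imaginary part, so H - n divides P. -/
theorem exists_eq_denom_mul (e : ℂ) (D : List ℤ) (P : MvPolynomial (Fin 2) ℂ)
    (hP : reflect (denom D) * P = MvPolynomial.C e * denom D * reflect P) :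
    ∃ Q, P = denom D * Q ∧ Q = MvPolynomial.C e * reflect Q := by
  induction D generalizing P with
  | nil => exact ⟨P, by simp [denom], by simpa [denom] using hP⟩
  | cons n D ih =>
    obtain ⟨Q, rfl⟩ : (MvPolynomial.X 0 + MvPolynomial.X 1 - MvPolynomial.C (n : ℂ)) ∣ P := by
      refine linear_dvd_of_eval fun l hl => ?_
      have h1 := congr_arg (MvPolynomial.eval ![l, n - l]) hP
      have h2 : MvPolynomial.eval ![l, n - l] (denom (n :: D)) = 0 := by simp [denom_cons]
      rw [map_mul, map_mul, map_mul, h2, mul_zero, zero_mul, eval_reflect] at h1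
      -- At the reflected point (1 - l, n - l) the sum of coordinates has imaginary part -2 Im l, so
      -- it is not an integer.
      refine (mul_eq_zero.1 h1).resolve_left (eval_denom_ne_zero fun k hk => ?_)
      have := congr_arg Complex.im hk
      simp at this
      linarith
    set L : MvPolynomial (Fin 2) ℂ :=
      MvPolynomial.X 0 + MvPolynomial.X 1 - MvPolynomial.C (n : ℂ) with hL
    have hL0 : L ≠ 0 := linear_ne_zero n
    have hL1 : reflect L ≠ 0 := fun h0 => hL0 (by rw [← reflect_reflect L, h0, map_zero])
    obtain ⟨R, hR, hR'⟩ := ih Q (by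
      rw [denom_cons, ← hL, map_mul, map_mul] at hP
      refine mul_left_cancel₀ (mul_ne_zero hL0 hL1) ?_
      linear_combination hP)
    exact ⟨R, by rw [denom_cons, hR, mul_assoc], hR'⟩

/-- A rational function of `l` and `m` with poles on the lines `l + m = n` only, which is symmetric
or antisymmetric under `l ↦ 1 - l`, is a polynomial. -/
theorem exists_polynomial {e : ℂ} {f : ∀ l m : ℂ, (∀ n : ℤ, l + m ≠ n) → ℂ} {D : List ℤ}
    {P : MvPolynomial (Fin 2) ℂ} (hf : ∀ l m hlm, MvPolynomial.eval ![l, m] (denom D) * f l m hlm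
      = MvPolynomial.eval ![l, m] P)
    (hr : ∀ (j : ℕ) (m : ℂ) (_ : 0 < m.im) h1 h2, f (-j) m h1 = e * f (j + 1) m h2) :
    ∃ Q, (∀ l m hlm, f l m hlm = MvPolynomial.eval ![l, m] Q) ∧
      Q = MvPolynomial.C e * reflect Q := by
  obtain ⟨Q, hQ, hQ'⟩ := exists_eq_denom_mul e D P (by
    -- The reflection law is known only for l = -j, but these points already form an infinite set.
    refine MvPolynomial.funext_set ![Set.range fun j : ℕ => (-j : ℂ), {z : ℂ | 0 < z.im}]
      (fun i => ?_) fun x hx => ?_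
    · fin_cases i
      · exact Set.infinite_range_of_injective fun a b hab => by simpa using hab
      · refine Set.infinite_of_injective_forall_mem (f := fun n : ℕ => (⟨n, 1⟩ : ℂ))
          (fun a b hab => ?_) fun n => by simp
        simpa using congr_arg Complex.re hab
    · obtain ⟨j, hj⟩ := hx 0 trivial
      have hm : 0 < (x 1).im := hx 1 trivial
      have ex : x = ![-(j : ℂ), x 1] := by ext i; fin_cases i <;> simp [← hj]
      have h1 := add_ne_int (l := -(j : ℂ)) (by simp) hm
      have h2 := add_ne_int (l := (j : ℂ) + 1) (by simp) hm
      rw [ex]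
      simp only [map_mul, eval_reflect, MvPolynomial.eval_C, sub_neg_eq_add]
      rw [add_comm 1 (j : ℂ), ← hf _ _ h1, ← hf _ _ h2, hr j _ hm h1 h2]
      ring)
  refine ⟨Q, fun l m hlm => ?_, hQ'⟩
  refine mul_left_cancel₀ (eval_denom_ne_zero (D := D) hlm) ?_
  rw [hf, hQ, map_mul]

/-! ### The target algebra -/

theorem X_mul_X_mem_target (i j : Fin 2) :
    (MvPolynomial.X i * MvPolynomial.X j : MvPolynomial (Fin 2) ℂ) ∈ PolySide.target := by
  have h1 : (MvPolynomial.X 0 ^ 2 + MvPolynomial.X 1 ^ 2 : MvPolynomial (Fin 2) ℂ) ∈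
    PolySide.target := Algebra.subset_adjoin (by simp)
  have h2 : (2 * MvPolynomial.X 0 * MvPolynomial.X 1 : MvPolynomial (Fin 2) ℂ) ∈
    PolySide.target := Algebra.subset_adjoin (by simp)
  have h3 : (MvPolynomial.X 0 ^ 2 - MvPolynomial.X 1 ^ 2 : MvPolynomial (Fin 2) ℂ) ∈
    PolySide.target := Algebra.subset_adjoin (by simp)
  have hC : (MvPolynomial.C (1 / 2 : ℂ) * 2 : MvPolynomial (Fin 2) ℂ) = 1 := by
    rw [← map_ofNat MvPolynomial.C 2, ← map_mul]; norm_num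
  have hs {a : MvPolynomial (Fin 2) ℂ} (ha : a ∈ PolySide.target) :
      MvPolynomial.C (1 / 2 : ℂ) * a ∈ PolySide.target := by
    rw [← MvPolynomial.smul_eq_C_mul]; exact Subalgebra.smul_mem _ ha _
  have h01 : (MvPolynomial.X 0 * MvPolynomial.X 1 : MvPolynomial (Fin 2) ℂ) ∈ PolySide.target := by
    convert hs h2 using 1
    linear_combination (-MvPolynomial.X 0 * MvPolynomial.X 1) * hC
  fin_cases i <;> fin_cases j
  · convert hs (add_mem h1 h3) using 1
    simp only [Fin.zero_eta]
    linear_combination (-MvPolynomial.X 0 * MvPolynomial.X 0) * hC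
  · exact h01
  · simpa [mul_comm] using h01
  · convert hs (sub_mem h1 h3) using 1
    simp only [Fin.mk_one]
    linear_combination (-MvPolynomial.X 1 * MvPolynomial.X 1) * hC

/-- Even polynomials belong to the target algebra. -/
theorem mem_target_of_even {p : MvPolynomial (Fin 2) ℂ}
    (hp : ∀ x y, MvPolynomial.eval ![x, y] p = MvPolynomial.eval ![-x, -y] p) :
    p ∈ PolySide.target := by
  set T : MvPolynomial (Fin 2) ℂ →ₐ[ℂ] MvPolynomial (Fin 2) ℂ :=
    MvPolynomial.aeval ![-MvPolynomial.X 0, -MvPolynomial.X 1] with hT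
  have hTX (i : Fin 2) : T (MvPolynomial.X i) = -MvPolynomial.X i := by
    fin_cases i <;> simp [hT]
  -- Multiplication by a variable exchanges even and odd parts, so the induction also carries each
  -- variable times the odd part.
  have h1 (q : MvPolynomial (Fin 2) ℂ) : q + T q ∈ PolySide.target ∧
      ∀ i, MvPolynomial.X i * (q - T q) ∈ PolySide.target := by
    induction q using MvPolynomial.induction_on with
    | C a =>
      rw [← MvPolynomial.algebraMap_eq, AlgHom.commutes]
      exact ⟨add_mem (Subalgebra.algebraMap_mem _ _) (Subalgebra.algebraMap_mem _ _), by simp⟩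
    | add q r hq hr =>
      rw [map_add, add_add_add_comm, add_sub_add_comm]
      exact ⟨add_mem hq.1 hr.1, fun i => by rw [mul_add]; exact add_mem (hq.2 i) (hr.2 i)⟩
    | mul_X q j hq =>
      rw [map_mul, hTX]
      refine ⟨?_, fun i => ?_⟩
      · convert hq.2 j using 1; ring
      · convert mul_mem (X_mul_X_mem_target i j) hq.1 using 1; ring
  have h2 (q : MvPolynomial (Fin 2) ℂ) (x y : ℂ) :
      MvPolynomial.eval ![x, y] (T q) = MvPolynomial.eval ![-x, -y] q := by
    induction q using MvPolynomial.induction_on with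
    | C a => rw [← MvPolynomial.algebraMap_eq, AlgHom.commutes]; simp
    | add P Q hP hQ => simp [hP, hQ]
    | mul_X P i hP =>
      rw [map_mul, map_mul, hP, map_mul, hTX]
      fin_cases i <;> simp
  have h3 : T p = p := sub_eq_zero.1 (eq_zero_of_eval fun x y _ _ _ => by
    rw [map_sub, h2, ← hp, sub_self])
  have h4 : p = (1 / 2 : ℂ) • (p + T p) := by rw [h3]; module
  rw [h4]
  exact Subalgebra.smul_mem _ (h1 p).1 _

/-! ### Elements of weight zero which commute or anticommute with the lowering operators -/

/-- Modulo `I`, the element `u` commutes with `H`, and commutes up to the sign `e` with the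
lowering operators. -/
structure IsGhost (e : ℂ) (u : U) : Prop where
  sq : e * e = 1
  weight : X h * u - u * X h ∈ I
  lower : ∀ i, u * lowering i - e • (lowering i * u) ∈ I

/-- `u` acts on the highest weight vector by the polynomial `p` in `x = l + m - 1`, `y = l - m`. -/
def HasChar (u : U) (p : MvPolynomial (Fin 2) ℂ) : Prop :=
  ∀ l m hlm, verma l m hlm u hwVec = MvPolynomial.eval ![l + m - 1, l - m] p • hwVec

/-- The weight l + m occurs in V only at the coordinate (0, 0). -/
theorem eigen_of_weight {u : U} (hu : X h * u - u * X h ∈ I) (l m : ℂ) (hlm : ∀ n : ℤ, l + m ≠ n) :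
    verma l m hlm u hwVec = verma l m hlm u hwVec 0 0 • hwVec := by
  have h1 := verma_mem_I (hlm := hlm) verma_X_f_hwVec hu
  have h2 : verma l m hlm (X h) hwVec = (l + m) • hwVec := by
    have := verma_X_h_lowVec (hlm := hlm) 0
    rwa [lowVec_zero, Nat.cast_zero, add_zero] at this
  rw [map_sub, map_mul, map_mul, LinearMap.sub_apply, Module.End.mul_apply, Module.End.mul_apply,
    h2, map_smul, sub_eq_zero] at h1
  ext p q
  have h3 := congr_fun (congr_fun h1 p) q
  rw [verma_X_h, diag_apply, Pi.smul_apply, Pi.smul_apply, smul_eq_mul] at h3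
  rw [Pi.smul_apply, Pi.smul_apply, smul_eq_mul, hwVec]
  split_ifs with hpq
  · rw [hpq.1, hpq.2, mul_one]
  · have h4 : ((p + q : ℕ) : ℂ) * verma l m hlm u hwVec p q = 0 := by
      push_cast; linear_combination h3
    rw [mul_zero]
    exact (mul_eq_zero.1 h4).resolve_left (Nat.cast_ne_zero.2 (by omega))

namespace IsGhost

variable {e : ℂ} {u : U}

theorem verma_lowVec (hu : IsGhost e u) {l m : ℂ} {hlm : ∀ n : ℤ, l + m ≠ n} (k : ℕ) :
    verma l m hlm u (lowVec l m hlm k)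
      = (e ^ k * verma l m hlm u hwVec 0 0) • lowVec l m hlm k := by
  induction k with
  | zero => rw [lowVec_zero, pow_zero, one_mul]; exact eigen_of_weight hu.weight l m hlm
  | succ k ih =>
    have h1 := verma_mem_I (verma_X_f_lowVec (hlm := hlm) k) (hu.lower 0)
    rw [map_sub, map_smul, map_mul, map_mul, LinearMap.sub_apply, LinearMap.smul_apply,
      Module.End.mul_apply, Module.End.mul_apply, ih, map_smul, sub_eq_zero] at h1
    rw [lowVec_succ, h1, smul_smul]
    congr 1
    ring

/-- In M(-j) ⊗ M(m), u acts on `lowVec (2j+1)` by e^(2j+1) = e times its scalar at (-j, m). That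
vector is a nonzero multiple of the embedded highest weight vector of M(j+1) ⊗ M(m), where u acts by
its scalar at (j + 1, m). -/
theorem reflection (hu : IsGhost e u) (j : ℕ) (m : ℂ) (hm : 0 < m.im)
    (h1 : ∀ n : ℤ, (-j : ℂ) + m ≠ n) (h2 : ∀ n : ℤ, (j + 1 : ℂ) + m ≠ n) :
    verma (-j) m h1 u hwVec 0 0 = e * verma (j + 1) m h2 u hwVec 0 0 := by
  have hne : (-j : ℂ) ≠ m := fun h0 => ne_int hm (-j) (by push_cast; exact h0.symm)
  have hc := lowVec_ne_zero (hlm := h1) (ne_int hm) hne (2 * j + 1)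
  have h3 := hu.verma_lowVec (hlm := h1) (2 * j + 1)
  have he : e ^ (2 * j + 1) = e := by rw [pow_succ, pow_mul, pow_two, hu.sq, one_pow, one_mul]
  rw [lowVec_reflect j (ne_int hm) h1, map_smul, smul_comm, ← shiftV_verma j h2,
    eigen_of_weight hu.weight _ _ h2, map_smul, he] at h3
  have h4 := smul_right_injective V hc h3
  have h5 := congr_fun (congr_fun h4 (0 + (2 * j + 1))) 0
  simp only [Pi.smul_apply, shiftV_add, smul_eq_mul, hwVec_zero, pow_zero, mul_one] at h5
  rw [h5, ← mul_assoc, hu.sq, one_mul]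

theorem swap (hu : IsGhost e u) : IsGhost e (swap u) where
  sq := hu.sq
  weight := by simpa [swap_X] using swap_mem_I hu.weight
  lower i := by simpa [swap_lowering] using swap_mem_I (hu.lower (1 - i))

theorem exists_eval (hu : IsGhost e u) : ∃ Q,
    (∀ l m hlm, verma l m hlm u hwVec 0 0 = MvPolynomial.eval ![l, m] Q) ∧
      ∀ l m, MvPolynomial.eval ![l, m] Q = e * MvPolynomial.eval ![1 - l, m] Q := by
  obtain ⟨D, P, hP⟩ := exists_denom_mul_eq_eval u
  obtain ⟨Q, hQ, hQ'⟩ := exists_polynomial (f := fun l m hlm => verma l m hlm u hwVec 0 0) hP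
    hu.reflection
  refine ⟨Q, hQ, fun l m => ?_⟩
  nth_rewrite 1 [hQ']
  rw [map_mul, eval_reflect, MvPolynomial.eval_C]

theorem exists_hasChar (hu : IsGhost e u) : ∃ p ∈ PolySide.target, HasChar u p ∧
    ∀ x y, MvPolynomial.eval ![x, y] p = e * MvPolynomial.eval ![y, x] p := by
  obtain ⟨Q, hQ, hQs⟩ := hu.exists_eval
  obtain ⟨Q', hQ', hQs'⟩ := hu.swap.exists_eval
  -- The exchanged element has the scalar with l and m interchanged, so its reflection law is the
  -- one in m.
  have hsw (l m : ℂ) : MvPolynomial.eval ![l, m] Q' = MvPolynomial.eval ![m, l] Q := by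
    have : Q' = MvPolynomial.rename (Equiv.swap 0 1) Q := by
      refine sub_eq_zero.1 (eq_zero_of_eval fun l m hl hm _ => ?_)
      have hlm := add_ne_int hl.le hm
      have hml := add_ne_int hm.le hl
      have h1 := congr_fun (congr_fun (swapV_verma hml hlm u hwVec) 0) 0
      have h2 : swapV hwVec = hwVec := by
        ext p q
        by_cases hpq : p = 0 ∧ q = 0
        · simp [hwVec, hpq.1, hpq.2]
        · have : ¬(q = 0 ∧ p = 0) := fun h0 => hpq h0.symm
          simp [hwVec, hpq, this]
      rw [h2, swapV_apply, mul_zero, pow_zero, one_mul, hQ, hQ'] at h1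
      have h3 : (![l, m] ∘ (Equiv.swap 0 1 : Equiv.Perm (Fin 2))) = ![m, l] := by
        ext i; fin_cases i <;> simp
      rw [map_sub, MvPolynomial.eval_rename, h3, h1, sub_self]
    have h3 : (![l, m] ∘ (Equiv.swap 0 1 : Equiv.Perm (Fin 2))) = ![m, l] := by
      ext i; fin_cases i <;> simp
    rw [this, MvPolynomial.eval_rename, h3]
  -- Inverse of the change of variables: l = (x + y + 1)/2, m = (x - y + 1)/2.
  set p : MvPolynomial (Fin 2) ℂ := MvPolynomial.aeval
    ![MvPolynomial.C (1 / 2) * (MvPolynomial.X 0 + MvPolynomial.X 1 + 1),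
      MvPolynomial.C (1 / 2) * (MvPolynomial.X 0 - MvPolynomial.X 1 + 1)] Q with hp
  have hev (x y : ℂ) : MvPolynomial.eval ![x, y] p
      = MvPolynomial.eval ![(x + y + 1) / 2, (x - y + 1) / 2] Q := by
    rw [hp]
    clear * -
    induction Q using MvPolynomial.induction_on with
    | C a => rw [← MvPolynomial.algebraMap_eq, AlgHom.commutes]; simp
    | add P Q hP hQ => rw [map_add, map_add, hP, hQ, map_add]
    | mul_X P i hP =>
      rw [map_mul, map_mul, hP, map_mul]
      fin_cases i
      · simp; left; ring
      · simp; left; ring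
  -- This is l ↦ 1 - l; the next symmetry is m ↦ 1 - m. Since e² = 1, composing them shows that p is
  -- even.
  have s1 (x y : ℂ) : MvPolynomial.eval ![x, y] p = e * MvPolynomial.eval ![-y, -x] p := by
    rw [hev, hev, hQs]
    congr 4 <;> ring_nf
  have s2 (x y : ℂ) : MvPolynomial.eval ![x, y] p = e * MvPolynomial.eval ![y, x] p := by
    rw [hev, hev, ← hsw, hQs', hsw]
    congr 4 <;> ring_nf
  refine ⟨p, mem_target_of_even fun x y => ?_, fun l m hlm => ?_, s2⟩
  · rw [s1, s2 (-y), ← mul_assoc, hu.sq, one_mul]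
  · rw [eigen_of_weight hu.weight, hQ, hev]
    congr 4 <;> ring_nf

/-- The scalars on all singular vectors are ± the one on the highest weight vector, so they vanish
with it. -/
theorem mem_I (hu : IsGhost e u) (h0 : HasChar u 0) : u ∈ I := by
  refine mem_I_of_verma fun l m _ _ _ hlm k => ?_
  rw [hu.verma_lowVec, h0]
  simp

end IsGhost

theorem HasChar.unique {u v : U} {p q : MvPolynomial (Fin 2) ℂ} (hu : HasChar u p)
    (hv : HasChar v q) (huv : u - v ∈ I) : p = q := by
  refine sub_eq_zero.1 (eq_zero_of_eval fun x y hx _ _ => ?_)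
  -- Here l + m = x + 1 with x not real.
  have hlm (n : ℤ) : (x + y + 1) / 2 + (x - y + 1) / 2 ≠ n := fun h0 => by
    have := congr_arg Complex.im h0
    rw [show (x + y + 1) / 2 + (x - y + 1) / 2 = x + 1 by ring] at this
    simp at this
    linarith
  have h1 := verma_mem_I (hlm := hlm) verma_X_f_hwVec huv
  rw [map_sub, LinearMap.sub_apply, hu, hv, ← sub_smul, ← map_sub] at h1
  have h2 := congr_fun (congr_fun h1 0) 0
  rw [show (x + y + 1) / 2 + (x - y + 1) / 2 - 1 = x by ring,
    show (x + y + 1) / 2 - (x - y + 1) / 2 = y by ring] at h2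
  simpa [hwVec] using h2

theorem HasChar.add {u v : U} {p q : MvPolynomial (Fin 2) ℂ} (hu : HasChar u p)
    (hv : HasChar v q) : HasChar (u + v) (p + q) := fun l m hlm => by
  rw [map_add, LinearMap.add_apply, hu, hv, map_add, add_smul]

theorem HasChar.mul {u v : U} {p q : MvPolynomial (Fin 2) ℂ} (hu : HasChar u p)
    (hv : HasChar v q) : HasChar (u * v) (p * q) := fun l m hlm => by
  rw [map_mul, Module.End.mul_apply, hv, map_smul, hu, smul_smul, map_mul, mul_comm]

theorem HasChar.smul {u : U} {p : MvPolynomial (Fin 2) ℂ} (c : ℂ) (hu : HasChar u p) :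
    HasChar (c • u) (c • p) := fun l m hlm => by
  rw [map_smul, LinearMap.smul_apply, hu, MvPolynomial.smul_eval, smul_smul]

theorem HasChar.scalar (c : ℂ) :
    HasChar (algebraMap ℂ U c) (algebraMap ℂ (MvPolynomial (Fin 2) ℂ) c) := fun l m hlm => by
  rw [AlgHom.commutes]; simp

/-! ### Odd elements of weight zero -/

/-- The parity operator on `V`. -/
def parityV : Module.End ℂ V := diag fun p q => (-1) ^ (p + q)

theorem parityV_gen {l m : ℂ} {hlm : ∀ n : ℤ, l + m ≠ n} (g : Gen) (v : V) :
    parityV (verma l m hlm (gen g) v)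
      = ((-1 : ℤˣ) ^ g.parity : ℤˣ) • verma l m hlm (gen g) (parityV v) := by
  have he (i : Fin 2) (v : V) :
      parityV (verma l m hlm (el i xm1) v) = -verma l m hlm (el i xm1) (parityV v) := by
    fin_cases i <;> ext (_ | p) (_ | q) <;>
      (simp [parityV, pow_succ, pow_add]; try ring)
  have hf (i : Fin 2) (v : V) :
      parityV (verma l m hlm (el i x1) v) = -verma l m hlm (el i x1) (parityV v) := by
    fin_cases i <;> ext p q <;> (simp [parityV, pow_succ, pow_add]; ring)
  match g with
  | .inv n =>
    change parityV (verma l m hlm (hinv n) v) = ((-1 : ℤˣ) ^ (0 : ZMod 2) : ℤˣ) •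
      verma l m hlm (hinv n) (parityV v)
    ext p q
    simp [parityV]
    ring
  | .base i b =>
    change parityV (verma l m hlm (el i b) v) = ((-1 : ℤˣ) ^ b.parity : ℤˣ) •
      verma l m hlm (el i b) (parityV v)
    cases b with
    | xm2 => simp [rel_e_e, Osp.parity, he]
    | xm1 => simp [Osp.parity, he]
    | h => simp [rel_h, Osp.parity, he, hf]
    | x1 => simp [Osp.parity, hf]
    | x2 => simp [rel_x2, Osp.parity, hf]

theorem parityV_verma {l m : ℂ} {hlm : ∀ n : ℤ, l + m ≠ n} {i : ZMod 2} {u : U}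
    (hu : u ∈ uPart i) (v : V) :
    parityV (verma l m hlm u v) = ((-1 : ℤˣ) ^ i : ℤˣ) • verma l m hlm u (parityV v) := by
  induction hu using Submodule.span_induction with
  | mem u hu =>
    obtain ⟨L, rfl, rfl⟩ := hu
    induction L with
    | nil => simp
    | cons g L ih =>
      simp only [List.map_cons, List.sum_cons, List.prod_cons, map_mul, Module.End.mul_apply,
        parityV_gen, ih, uzpow_add, mul_smul]
      rw [LinearMap.map_smul_of_tower]
  | zero => simp
  | add u v _ _ hu hv => simp [hu, hv]
  | smul c u _ hu => simp [hu, smul_comm c]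

/-- The highest weight vector is even and an odd element reverses parity, so its image has no
component along that vector. -/
theorem hasChar_zero_of_odd {u : U} (hw : X h * u - u * X h ∈ I) (hu : u ∈ uPart 1) :
    HasChar u 0 := fun l m hlm => by
  rw [eigen_of_weight hw]
  have h1 := congr_fun (congr_fun (parityV_verma (hlm := hlm) hu hwVec) 0) 0
  have h2 : parityV hwVec = hwVec := by
    ext p q
    by_cases hpq : p = 0 ∧ q = 0
    · simp [parityV, hpq.1, hpq.2]
    · simp [parityV, hwVec, hpq]
  rw [h2] at h1
  simp [parityV] at h1
  have h3 : verma l m hlm u hwVec 0 0 = 0 := by linear_combination h1 / 2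
  simp [h3]

/-! ### Central elements of `U` -/

theorem scasimir_e_same (i : Fin 2) :
    scasimir (el i) * el i xm1 = -(el i xm1 * scasimir (el i)) := by
  have e2 : el i xm1 * el i x1 * el i xm1
      = el i xm1 * el i h - el i xm1 * (el i xm1 * el i x1) := by
    rw [mul_assoc, rel_x1_xm1, mul_sub]
  simp only [scasimir, mul_sub, sub_mul, mul_smul_comm, smul_mul_assoc, ← Algebra.commutes,
    rel_h_e, e2, ← Algebra.smul_def]
  module

theorem scasimir_f_same (i : Fin 2) :
    scasimir (el i) * el i x1 = -(el i x1 * scasimir (el i)) := by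
  rw [scasimir_same, neg_neg]

theorem scasimir_e_ne {i j : Fin 2} (hij : i ≠ j) :
    scasimir (el i) * el j xm1 = el j xm1 * scasimir (el i) := by
  have h1 : el i xm1 * el i x1 * el j xm1 = el j xm1 * (el i xm1 * el i x1) := by
    rw [mul_assoc, cross_f_e hij, mul_neg, ← mul_assoc, cross_e_e hij, neg_mul, neg_neg, mul_assoc]
  simp only [scasimir, sub_mul, mul_sub, smul_mul_assoc, mul_smul_comm, cross_h hij, h1,
    Algebra.commutes]

/-- This reduces the parity of C, its commutation with x_{-α} and its character to those of Q. -/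
theorem casimir_eq_sq (i : Fin 2) : casimir (el i) = scasimir (el i) * scasimir (el i) := by
  have r1' (x : U) : el i x1 * (el i xm1 * x) = el i h * x - el i xm1 * (el i x1 * x) := by
    rw [← mul_assoc, rel_x1_xm1, sub_mul, mul_assoc]
  have r2' (x : U) : el i h * (el i xm1 * x) = el i xm1 * (el i h * x) + el i xm1 * x := by
    rw [← mul_assoc, rel_h_e, add_mul, mul_assoc]
  simp only [casimir, scasimir, rel_e_e, rel_x2, mul_sub, sub_mul, mul_add, mul_assoc,
    mul_neg, smul_mul_assoc, mul_smul_comm, r1', r2', rel_x1_h, Algebra.algebraMap_eq_smul_one,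
    one_mul, mul_one]
  module

/-- Supercommutation up to a sign, checked on generators. -/
theorem mul_eq_of_gen {k : ZMod 2} {u : U}
    (he : ∀ i, u * el i xm1 = ((-1 : ℤˣ) ^ k : ℤˣ) • (el i xm1 * u))
    (hf : ∀ i, u * el i x1 = ((-1 : ℤˣ) ^ k : ℤˣ) • (el i x1 * u)) {j : ZMod 2} {b : U}
    (hb : b ∈ uPart j) : u * b = ((-1 : ℤˣ) ^ (k * j) : ℤˣ) • (b * u) := by
  have hmul {x y : U} {s t : ℤˣ} (hx : u * x = s • (x * u)) (hy : u * y = t • (y * u)) :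
      u * (x * y) = (s * t) • (x * y * u) := by
    rw [← mul_assoc, hx, smul_mul_assoc, mul_assoc, hy, mul_smul_comm, smul_smul, mul_assoc]
  have hk : ((-1 : ℤˣ) ^ k : ℤˣ) * ((-1 : ℤˣ) ^ k : ℤˣ) = 1 := by
    rw [← uzpow_add, CharTwo.add_self_eq_zero, uzpow_zero]
  have hee (i : Fin 2) := hmul (he i) (he i)
  have hff (i : Fin 2) := hmul (hf i) (hf i)
  have hef (i : Fin 2) := hmul (he i) (hf i)
  have hfe (i : Fin 2) := hmul (hf i) (he i)
  rw [hk] at *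
  have hh (i : Fin 2) : u * el i h = el i h * u := by
    rw [rel_h, mul_add, hef, hfe, one_smul, one_smul, add_mul]
  have hgen (g : Gen) : u * gen g = ((-1 : ℤˣ) ^ (k * g.parity) : ℤˣ) • (gen g * u) := by
    match g with
    | .inv n =>
      change u * hinv n = ((-1 : ℤˣ) ^ (k * 0) : ℤˣ) • (hinv n * u)
      rw [mul_zero, uzpow_zero, one_smul]
      have hs : u * shift n = shift n * u := by
        simp only [shift, X, mul_sub, sub_mul, mul_add, add_mul, hh, Algebra.commutes]
      calc u * hinv n = hinv n * (shift n * u) * hinv n := by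
            rw [← mul_assoc, hinv_mul_shift, one_mul]
        _ = hinv n * u := by
            rw [← hs, mul_assoc, mul_assoc, shift_mul_hinv, mul_one]
    | .base i b =>
      change u * el i b = ((-1 : ℤˣ) ^ (k * b.parity) : ℤˣ) • (el i b * u)
      cases b with
      | xm2 => simpa [rel_e_e, Osp.parity] using hee i
      | xm1 => simpa [Osp.parity] using he i
      | h => simpa [Osp.parity] using hh i
      | x1 => simpa [Osp.parity] using hf i
      | x2 => simpa [rel_x2, Osp.parity] using hff i
  induction hb using Submodule.span_induction with
  | mem b hb =>
    obtain ⟨L, rfl, rfl⟩ := hb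
    induction L with
    | nil => simp
    | cons g L ih =>
      rw [List.map_cons, List.map_cons, List.prod_cons, List.sum_cons, hmul (hgen g) ih, mul_add,
        uzpow_add]
  | zero => simp
  | add x y _ _ hx hy => rw [mul_add, hx, hy, add_mul, smul_add]
  | smul c x _ hx => rw [mul_smul_comm, hx, smul_mul_assoc, smul_comm]

theorem scasimir_mem_uPart (i : Fin 2) : scasimir (el i) ∈ uPart 0 := by
  have h1 : el i xm1 * el i x1 ∈ uPart (1 + 1) :=
    uPart_mul (el_mem_uPart i xm1) (el_mem_uPart i x1)
  rw [show (1 + 1 : ZMod 2) = 0 by decide] at h1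
  have h2 : el i h ∈ uPart 0 := el_mem_uPart i h
  rw [scasimir, Algebra.algebraMap_eq_smul_one]
  exact sub_mem (sub_mem (Submodule.smul_mem _ _ h2) h1) (Submodule.smul_mem _ _ uPart_one)

theorem casimir_mem_uPart (i : Fin 2) : casimir (el i) ∈ uPart 0 := by
  rw [casimir_eq_sq]
  simpa using uPart_mul (scasimir_mem_uPart i) (scasimir_mem_uPart i)

theorem toZ_eq_iff {u v : N} : toZ u = toZ v ↔ (u : U) - v ∈ I := by
  rw [toZ, Ideal.Quotient.mkₐ_eq_mk, Ideal.Quotient.eq]; rfl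

theorem toZ_mem_ghostPart {k : ZMod 2} {u : N} (hu : (u : U) ∈ uPart 0)
    (he : ∀ i, (u : U) * el i xm1 = ((-1 : ℤˣ) ^ k : ℤˣ) • (el i xm1 * u))
    (hf : ∀ i, (u : U) * el i x1 = ((-1 : ℤˣ) ^ k : ℤˣ) • (el i x1 * u)) :
    toZ u ∈ Superalgebra.ghostPart zPart 0 k := by
  refine ⟨⟨u, hu, rfl⟩, ?_⟩
  rintro j _ ⟨b, hb, rfl⟩
  have h1 : u * b = ((-1 : ℤˣ) ^ ((0 + k) * j) : ℤˣ) • (b * u) := by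
    apply Subtype.ext
    rw [zero_add]
    simpa [Units.smul_def] using mul_eq_of_gen he hf hb
  change toZ u * toZ b = _ • (toZ b * toZ u)
  rw [← map_mul, h1, ← map_mul, Units.smul_def, Units.smul_def, map_zsmul]

theorem casimir_mem_ghostPart (i : Fin 2) :
    toZ ⟨casimir (el i), casimir_mem i⟩ ∈ Superalgebra.ghostPart zPart 0 0 := by
  refine toZ_mem_ghostPart (casimir_mem_uPart i) (fun j => ?_) fun j => ?_
  · rw [uzpow_zero, one_smul]
    change casimir (el i) * el j xm1 = el j xm1 * casimir (el i)
    rw [casimir_eq_sq]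
    by_cases hij : i = j
    · subst hij
      rw [mul_assoc, scasimir_e_same, mul_neg, ← mul_assoc, scasimir_e_same, neg_mul, neg_neg,
        mul_assoc]
    · rw [mul_assoc, scasimir_e_ne hij, ← mul_assoc, scasimir_e_ne hij, mul_assoc]
  · rw [uzpow_zero, one_smul]
    by_cases hij : i = j
    · subst hij; exact (casimir_same i).symm
    · exact (casimir_ne hij).symm

theorem scasimir_mem_ghostPart : toZ ⟨scasimir (el 0) * scasimir (el 1), scasimir_mem⟩ ∈
    Superalgebra.ghostPart zPart 0 1 := by
  refine toZ_mem_ghostPart ?_ (fun j => ?_) fun j => ?_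
  · simpa using uPart_mul (scasimir_mem_uPart 0) (scasimir_mem_uPart 1)
  · rw [uzpow_one, Units.neg_smul, one_smul]
    change scasimir (el 0) * scasimir (el 1) * el j xm1
      = -(el j xm1 * (scasimir (el 0) * scasimir (el 1)))
    fin_cases j
    · simp only [Fin.zero_eta]
      rw [mul_assoc, scasimir_e_ne (one_ne_zero' (Fin 2)), ← mul_assoc, scasimir_e_same, neg_mul,
        mul_assoc]
    · simp only [Fin.mk_one]
      rw [mul_assoc, scasimir_e_same, mul_neg, ← mul_assoc, scasimir_e_ne (zero_ne_one' (Fin 2)),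
        mul_assoc]
  · rw [uzpow_one, Units.neg_smul, one_smul]
    change scasimir (el 0) * scasimir (el 1) * el j x1
      = -(el j x1 * (scasimir (el 0) * scasimir (el 1)))
    fin_cases j
    · simp only [Fin.zero_eta]
      rw [mul_assoc, ← scasimir_ne (one_ne_zero' (Fin 2)), ← mul_assoc, scasimir_f_same, neg_mul,
        mul_assoc]
    · simp only [Fin.mk_one]
      rw [mul_assoc, scasimir_f_same, mul_neg, ← mul_assoc, ← scasimir_ne (zero_ne_one' (Fin 2)),
        mul_assoc]

/-- On the highest weight vector x_α acts by zero, leaving l/2 - 1/4 = (x + y)/4 or m/2 - 1/4 = (x -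
y)/4. -/
theorem hasChar_scasimir (i : Fin 2) : HasChar (scasimir (el i)) (MvPolynomial.C (1 / 4) *
    (MvPolynomial.X 0 + (if i = 0 then 1 else -1) * MvPolynomial.X 1)) := by
  intro l m hlm
  have h0 : lowerL l hwVec = 0 := by ext p q; simp [hwVec]
  have h1 : lowerR m hwVec = 0 := by ext p q; simp [hwVec]
  ext p q
  fin_cases i
  · simp only [scasimir, Fin.zero_eta, map_sub, map_smul, map_mul, verma_h_zero, verma_e_zero,
      verma_f_zero, AlgHom.commutes, LinearMap.sub_apply, LinearMap.smul_apply,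
      Module.End.mul_apply, h0, map_zero, Module.algebraMap_end_apply, Pi.sub_apply, Pi.smul_apply,
      diag_apply, smul_eq_mul, Pi.zero_apply, if_true, MvPolynomial.eval_C, map_add,
      MvPolynomial.eval_X, map_one, Matrix.cons_val_zero, Matrix.cons_val_one, hwVec]
    split_ifs with hpq
    · rw [hpq.1]; push_cast; ring
    · ring
  · simp only [scasimir, Fin.mk_one, map_sub, map_smul, map_mul, verma_h_one, verma_e_one,
      verma_f_one, AlgHom.commutes, LinearMap.sub_apply, LinearMap.smul_apply,
      Module.End.mul_apply, h1, map_zero, Module.algebraMap_end_apply, Pi.sub_apply, Pi.smul_apply,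
      diag_apply, smul_eq_mul, Pi.zero_apply, one_ne_zero, if_false, MvPolynomial.eval_C, map_add,
      MvPolynomial.eval_X, map_neg, map_one, Matrix.cons_val_zero, Matrix.cons_val_one, hwVec]
    split_ifs with hpq
    · rw [hpq.2]; push_cast; ring
    · ring

/-! ### The ghost center of `Z` -/

/-- The sign attached to an element of `ℤ₂`. -/
def sign (k : ZMod 2) : ℂ := if k = 0 then 1 else -1

theorem units_smul_eq {M : Type*} [AddCommGroup M] [Module ℂ M] (k : ZMod 2) (x : M) :
    ((-1 : ℤˣ) ^ k : ℤˣ) • x = sign k • x := by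
  fin_cases k
  · change ((-1 : ℤˣ) ^ (0 : ZMod 2) : ℤˣ) • x = sign 0 • x
    simp [sign]
  · change ((-1 : ℤˣ) ^ (1 : ZMod 2) : ℤˣ) • x = sign 1 • x
    simp [sign]

theorem zmod_two_cases (k : ZMod 2) : k = 0 ∨ k = 1 := by
  revert k; decide

theorem sign_mul_self (k : ZMod 2) : sign k * sign k = 1 := by
  unfold sign; split_ifs <;> norm_num

theorem X_h_mem_N : X h ∈ N :=
  mem_N_of_X_f_mul_mem (by
    rw [X_f_X_h]; exact add_mem (I.mul_mem_left _ X_f_mem) X_f_mem)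

/-- Only two tests of the ghost condition are used: against H, which is even, and against the
lowering operators, which are odd. The sign in the second is (-1)^(i + k). -/
theorem isGhost_of_mem {i k : ZMod 2} {z : Z} (hz : z ∈ Superalgebra.ghostPart zPart i k) :
    ∃ u : N, (u : U) ∈ uPart i ∧ toZ u = z ∧ IsGhost (sign (i + k)) (u : U) := by
  obtain ⟨⟨u, hu, rfl⟩, hz⟩ := hz
  have hc (j : ZMod 2) (b : N) (hb : (b : U) ∈ uPart j) :
      toZ (u * b) = ((-1 : ℤˣ) ^ ((i + k) * j) : ℤˣ) • toZ (b * u) := by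
    rw [map_mul, map_mul]
    exact hz j (toZ b) ⟨b, hb, rfl⟩
  refine ⟨u, hu, rfl, sign_mul_self _, ?_, fun j => ?_⟩
  · have h1 := hc 0 ⟨X h, X_h_mem_N⟩ (X_mem_uPart h)
    rw [mul_zero, uzpow_zero, one_smul] at h1
    simpa using toZ_eq_iff.1 h1.symm
  · have h1 := hc 1 ⟨lowering j, lowering_mem_N j⟩ (lowering_mem_uPart j)
    rw [mul_one, units_smul_eq, ← map_smul] at h1
    simpa using toZ_eq_iff.1 h1

/-- `z` has a representative which acts on highest weight vectors by the polynomial `p`. -/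
def HasCharZ (z : Z) (p : MvPolynomial (Fin 2) ℂ) : Prop :=
  ∃ u : N, toZ u = z ∧ HasChar u p

theorem HasCharZ.unique {z : Z} {p q : MvPolynomial (Fin 2) ℂ} (hp : HasCharZ z p)
    (hq : HasCharZ z q) : p = q := by
  obtain ⟨u, rfl, hu⟩ := hp
  obtain ⟨v, hvu, hv⟩ := hq
  exact hu.unique hv (toZ_eq_iff.1 hvu.symm)

theorem HasCharZ.add {z w : Z} {p q : MvPolynomial (Fin 2) ℂ} (hp : HasCharZ z p)
    (hq : HasCharZ w q) : HasCharZ (z + w) (p + q) := by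
  obtain ⟨u, rfl, hu⟩ := hp
  obtain ⟨v, rfl, hv⟩ := hq
  exact ⟨u + v, map_add _ _ _, hu.add hv⟩

theorem HasCharZ.mul {z w : Z} {p q : MvPolynomial (Fin 2) ℂ} (hp : HasCharZ z p)
    (hq : HasCharZ w q) : HasCharZ (z * w) (p * q) := by
  obtain ⟨u, rfl, hu⟩ := hp
  obtain ⟨v, rfl, hv⟩ := hq
  exact ⟨u * v, map_mul _ _ _, hu.mul hv⟩

theorem HasCharZ.smul {z : Z} {p : MvPolynomial (Fin 2) ℂ} (c : ℂ) (hp : HasCharZ z p) :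
    HasCharZ (c • z) (c • p) := by
  obtain ⟨u, rfl, hu⟩ := hp
  exact ⟨c • u, map_smul _ _ _, hu.smul c⟩

theorem HasCharZ.scalar (c : ℂ) :
    HasCharZ (algebraMap ℂ Z c) (algebraMap ℂ (MvPolynomial (Fin 2) ℂ) c) :=
  ⟨algebraMap ℂ N c, toZ.commutes c, HasChar.scalar c⟩

theorem exists_hasCharZ_of_mem {k : ZMod 2} {z : Z}
    (hz : z ∈ Superalgebra.ghostPart zPart 0 k) : ∃ p ∈ PolySide.target, HasCharZ z p ∧
      ∀ x y, MvPolynomial.eval ![x, y] p = sign k * MvPolynomial.eval ![y, x] p := by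
  obtain ⟨u, -, rfl, hu⟩ := isGhost_of_mem hz
  rw [zero_add] at hu
  obtain ⟨p, hp, hup, hs⟩ := hu.exists_hasChar
  exact ⟨p, hp, ⟨u, rfl, hup⟩, hs⟩

theorem eq_zero_of_mem_ghostPart {i k : ZMod 2} {z : Z}
    (hz : z ∈ Superalgebra.ghostPart zPart i k) (h0 : HasCharZ z 0) : z = 0 := by
  obtain ⟨u, -, rfl, hu⟩ := isGhost_of_mem hz
  obtain ⟨v, hv, hv0⟩ := h0
  rw [← map_zero toZ, toZ_eq_iff]
  have h1 : HasChar u 0 := fun l m hlm => by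
    have h2 := verma_mem_I (hlm := hlm) verma_X_f_hwVec (toZ_eq_iff.1 hv)
    rw [map_sub, LinearMap.sub_apply, hv0, sub_eq_zero] at h2
    exact h2.symm
  simpa using hu.mem_I h1

theorem ghostPart_odd_eq_zero {k : ZMod 2} {z : Z}
    (hz : z ∈ Superalgebra.ghostPart zPart 1 k) : z = 0 := by
  obtain ⟨u, hu, hz', hg⟩ := isGhost_of_mem hz
  exact eq_zero_of_mem_ghostPart hz ⟨u, hz', hasChar_zero_of_odd hg.weight hu⟩

theorem exists_add_of_mem_ghostCenter {z : Z} (hz : z ∈ Superalgebra.ghostCenter zPart) :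
    ∃ a ∈ Superalgebra.ghostPart zPart 0 0, ∃ b ∈ Superalgebra.ghostPart zPart 0 1, z = a + b := by
  change z ∈ ⨆ p : ZMod 2 × ZMod 2, Superalgebra.ghostPart zPart p.1 p.2 at hz
  induction hz using Submodule.iSup_induction' with
  | zero => exact ⟨0, zero_mem _, 0, zero_mem _, by simp⟩
  | add x y _ _ hx hy =>
    obtain ⟨a, ha, b, hb, rfl⟩ := hx
    obtain ⟨a', ha', b', hb', rfl⟩ := hy
    exact ⟨a + a', add_mem ha ha', b + b', add_mem hb hb', by abel⟩
  | mem p x hx =>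
    obtain ⟨i, k⟩ := p
    rcases zmod_two_cases i with rfl | rfl
    · rcases zmod_two_cases k with rfl | rfl
      · exact ⟨x, hx, 0, zero_mem _, by simp⟩
      · exact ⟨0, zero_mem _, x, hx, by simp⟩
    · exact ⟨0, zero_mem _, 0, zero_mem _, by simp [ghostPart_odd_eq_zero hx]⟩

theorem ghostPart_le_ghostCenter (i k : ZMod 2) {z : Z}
    (hz : z ∈ Superalgebra.ghostPart zPart i k) : z ∈ Superalgebra.ghostCenter zPart :=
  Submodule.mem_iSup_of_mem (p := fun p : ZMod 2 × ZMod 2 => Superalgebra.ghostPart zPart p.1 p.2)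
    (i, k) hz

/-- A polynomial which is the sum of a symmetric and of an antisymmetric one, and itself has one of
these symmetries, has only one component. -/
theorem component_eq_zero {p q : MvPolynomial (Fin 2) ℂ} {s : ℂ} (hs : s ≠ 0)
    (hp : ∀ x y, MvPolynomial.eval ![x, y] p = s * MvPolynomial.eval ![y, x] p)
    (hpq : ∀ x y, MvPolynomial.eval ![x, y] (p + q) = -s * MvPolynomial.eval ![y, x] (p + q))
    (hq : ∀ x y, MvPolynomial.eval ![x, y] q = -s * MvPolynomial.eval ![y, x] q) : p = 0 := by
  refine eq_zero_of_eval fun x y _ _ _ => ?_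
  have h1 := hpq y x
  rw [map_add, map_add, hq y x, hp y x] at h1
  have h2 : s * MvPolynomial.eval ![x, y] p = 0 := by linear_combination h1 / 2
  exact (mul_eq_zero.1 h2).resolve_left hs

theorem exists_hasCharZ (z : Superalgebra.ghostCenter zPart) :
    ∃ p : PolySide.target, HasCharZ z p := by
  obtain ⟨a, ha, b, hb, hab⟩ := exists_add_of_mem_ghostCenter z.2
  obtain ⟨p, hp, hap, -⟩ := exists_hasCharZ_of_mem ha
  obtain ⟨q, hq, hbq, -⟩ := exists_hasCharZ_of_mem hb
  exact ⟨⟨p + q, add_mem hp hq⟩, by rw [hab]; exact hap.add hbq⟩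

/-- An element of the ghost center belongs to the anti-center or the center as soon as its
polynomial is antisymmetric or symmetric. -/
theorem mem_ghostPart_of_hasCharZ {k : ZMod 2} {z : Z} {p : MvPolynomial (Fin 2) ℂ}
    (hz : z ∈ Superalgebra.ghostCenter zPart) (hp : HasCharZ z p)
    (hs : ∀ x y, MvPolynomial.eval ![x, y] p = sign k * MvPolynomial.eval ![y, x] p) :
    z ∈ Superalgebra.ghostPart zPart 0 k := by
  obtain ⟨a, ha, b, hb, rfl⟩ := exists_add_of_mem_ghostCenter hz
  obtain ⟨q, -, hq, hqs⟩ := exists_hasCharZ_of_mem ha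
  obtain ⟨r, -, hr, hrs⟩ := exists_hasCharZ_of_mem hb
  obtain rfl := hp.unique (hq.add hr)
  -- The component of the wrong symmetry has polynomial zero, hence is itself zero.
  rcases zmod_two_cases k with rfl | rfl
  · obtain rfl : r = 0 := by
      rw [add_comm] at hs
      refine component_eq_zero (s := -1) (by norm_num) ?_ ?_ ?_ (p := r) (q := q)
      · simpa [sign] using hrs
      · simpa [sign] using hs
      · simpa [sign] using hqs
    rw [eq_zero_of_mem_ghostPart hb hr, add_zero]
    exact ha
  · obtain rfl : q = 0 := by
      refine component_eq_zero (s := 1) (by norm_num) ?_ ?_ ?_ (p := q) (q := r)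
      · simpa [sign] using hqs
      · simpa [sign] using hs
      · simpa [sign] using hrs
    rw [eq_zero_of_mem_ghostPart ha hq, zero_add]
    exact hb

/-- The zero polynomial is symmetric, so z is central, and the homogeneous case applies. -/
theorem eq_zero_of_hasCharZ {z : Z} (hz : z ∈ Superalgebra.ghostCenter zPart)
    (h0 : HasCharZ z 0) : z = 0 :=
  eq_zero_of_mem_ghostPart (mem_ghostPart_of_hasCharZ (k := 0) hz h0 (by simp)) h0

/-- The Harish-Chandra morphism of the ghost center. -/
def ghostHom : Superalgebra.ghostCenter zPart →ₐ[ℂ] PolySide.target where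
  toFun z := (exists_hasCharZ z).choose
  -- Each law holds because an element has only one polynomial, and polynomials add and multiply
  -- with representatives.
  map_one' := Subtype.ext <| (exists_hasCharZ 1).choose_spec.unique <| by
    simpa using HasCharZ.scalar 1
  map_mul' z w := Subtype.ext <| (exists_hasCharZ (z * w)).choose_spec.unique <|
    (exists_hasCharZ z).choose_spec.mul (exists_hasCharZ w).choose_spec
  map_zero' := Subtype.ext <| (exists_hasCharZ 0).choose_spec.unique <| by
    simpa using HasCharZ.scalar 0
  map_add' z w := Subtype.ext <| (exists_hasCharZ (z + w)).choose_spec.unique <|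
    (exists_hasCharZ z).choose_spec.add (exists_hasCharZ w).choose_spec
  commutes' c := Subtype.ext <| (exists_hasCharZ (algebraMap ℂ _ c)).choose_spec.unique <|
    HasCharZ.scalar c

theorem hasCharZ_ghostHom (z : Superalgebra.ghostCenter zPart) : HasCharZ z (ghostHom z) :=
  (exists_hasCharZ z).choose_spec

theorem ghostHom_eq {z : Superalgebra.ghostCenter zPart} {p : MvPolynomial (Fin 2) ℂ}
    (hz : HasCharZ z p) : (ghostHom z : MvPolynomial (Fin 2) ℂ) = p :=
  (hasCharZ_ghostHom z).unique hz

/-! ### The polynomials of the three generators -/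

theorem C1_mem : C1 ∈ Superalgebra.ghostCenter zPart := by
  refine ghostPart_le_ghostCenter 0 0 (Submodule.smul_mem _ _ ?_)
  rw [map_sub]
  exact sub_mem (casimir_mem_ghostPart 0) (casimir_mem_ghostPart 1)

theorem C2_mem : C2 ∈ Superalgebra.ghostCenter zPart := by
  refine ghostPart_le_ghostCenter 0 0 (Submodule.smul_mem _ _ ?_)
  rw [map_add]
  exact add_mem (casimir_mem_ghostPart 0) (casimir_mem_ghostPart 1)

theorem Q2_mem : Q2 ∈ Superalgebra.ghostCenter zPart :=
  ghostPart_le_ghostCenter 0 1 (Submodule.smul_mem _ _ scasimir_mem_ghostPart)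

theorem hasCharZ_casimir (i : Fin 2) : HasCharZ (toZ ⟨casimir (el i), casimir_mem i⟩)
    (MvPolynomial.C (1 / 16) *
      (MvPolynomial.X 0 + (if i = 0 then 1 else -1) * MvPolynomial.X 1) ^ 2) := by
  refine ⟨_, rfl, ?_⟩
  change HasChar (casimir (el i)) _
  have h1 := (hasChar_scasimir i).mul (hasChar_scasimir i)
  rw [← casimir_eq_sq] at h1
  convert h1 using 1
  rw [show (1 / 16 : ℂ) = 1 / 4 * (1 / 4) by norm_num, map_mul]
  ring

theorem hasCharZ_C1 : HasCharZ C1 (2 * MvPolynomial.X 0 * MvPolynomial.X 1) := by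
  have h1 := ((hasCharZ_casimir 0).add ((hasCharZ_casimir 1).smul (-1))).smul 8
  have e : C1 = (8 : ℂ) • (toZ ⟨casimir (el 0), casimir_mem 0⟩
      + (-1 : ℂ) • toZ ⟨casimir (el 1), casimir_mem 1⟩) := by
    rw [C1, map_sub, neg_one_smul, sub_eq_add_neg]
  rw [e]
  convert h1 using 1
  simp only [if_true, one_ne_zero, if_false, MvPolynomial.smul_eq_C_mul]
  have hC : (MvPolynomial.C 8 * MvPolynomial.C (1 / 16) * 2 : MvPolynomial (Fin 2) ℂ) = 1 := by
    rw [← map_ofNat MvPolynomial.C 2, ← map_mul, ← map_mul]; norm_num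
  have hC1 : (MvPolynomial.C (-1) : MvPolynomial (Fin 2) ℂ) = -1 := by simp
  rw [hC1]
  linear_combination (-2 * MvPolynomial.X 0 * MvPolynomial.X 1) * hC

theorem hasCharZ_C2 : HasCharZ C2 (MvPolynomial.X 0 ^ 2 + MvPolynomial.X 1 ^ 2) := by
  have h1 := ((hasCharZ_casimir 0).add (hasCharZ_casimir 1)).smul 8
  rw [C2, map_add]
  convert h1 using 1
  simp only [if_true, one_ne_zero, if_false, MvPolynomial.smul_eq_C_mul]
  have hC : (MvPolynomial.C 8 * MvPolynomial.C (1 / 16) * 2 : MvPolynomial (Fin 2) ℂ) = 1 := by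
    rw [← map_ofNat MvPolynomial.C 2, ← map_mul, ← map_mul]; norm_num
  linear_combination (-(MvPolynomial.X 0 ^ 2 + MvPolynomial.X 1 ^ 2)) * hC

theorem hasCharZ_Q2 : HasCharZ Q2 (MvPolynomial.X 0 ^ 2 - MvPolynomial.X 1 ^ 2) := by
  have h1 : HasCharZ Q2 _ := HasCharZ.smul 16
    ⟨⟨_, scasimir_mem⟩, rfl, (hasChar_scasimir 0).mul (hasChar_scasimir 1)⟩
  convert h1 using 1
  simp only [if_true, one_ne_zero, if_false, MvPolynomial.smul_eq_C_mul]
  have hC : (MvPolynomial.C 16 * MvPolynomial.C (1 / 4) * MvPolynomial.C (1 / 4) :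
      MvPolynomial (Fin 2) ℂ) = 1 := by
    rw [← map_mul, ← map_mul]; norm_num
  linear_combination (-(MvPolynomial.X 0 ^ 2 - MvPolynomial.X 1 ^ 2)) * hC

/-! ### Bijectivity and compatibility with the gradings -/

theorem ghostHom_injective : Function.Injective ghostHom := by
  rw [injective_iff_map_eq_zero]
  intro z hz
  have h1 := hasCharZ_ghostHom z
  rw [hz] at h1
  exact Subtype.ext (eq_zero_of_hasCharZ z.2 h1)

theorem ghostHom_surjective : Function.Surjective ghostHom := by
  have h1 : PolySide.target ≤ (PolySide.target.val.comp ghostHom).range := by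
    refine Algebra.adjoin_le ?_
    rintro _ (rfl | rfl | rfl)
    · exact ⟨⟨C2, C2_mem⟩, ghostHom_eq hasCharZ_C2⟩
    · exact ⟨⟨C1, C1_mem⟩, ghostHom_eq hasCharZ_C1⟩
    · exact ⟨⟨Q2, Q2_mem⟩, ghostHom_eq hasCharZ_Q2⟩
  rintro ⟨p, hp⟩
  obtain ⟨z, hz⟩ := h1 hp
  exact ⟨z, Subtype.ext hz⟩

theorem mem_polyPart_zero_iff {k : ZMod 2} {p : MvPolynomial (Fin 2) ℂ} :
    p ∈ PolySide.polyPart 0 k ↔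
      ∀ x y, MvPolynomial.eval ![x, y] p = sign k * MvPolynomial.eval ![y, x] p := by
  have h3 (x y : ℂ) : (![x, y] ∘ (Equiv.swap 0 1 : Equiv.Perm (Fin 2))) = ![y, x] := by
    ext i; fin_cases i <;> simp
  have h4 : p ∈ PolySide.polyPart 0 k ↔
      p = sign k • MvPolynomial.rename (Equiv.swap 0 1 : Equiv.Perm (Fin 2)) p := by
    rw [← units_smul_eq]
    simp [PolySide.polyPart]
  rw [h4]
  constructor
  · intro hp x y
    nth_rewrite 1 [hp]
    rw [MvPolynomial.smul_eval, MvPolynomial.eval_rename, h3]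
  · intro hp
    refine sub_eq_zero.1 (eq_zero_of_eval fun x y _ _ _ => ?_)
    rw [map_sub, MvPolynomial.smul_eval, MvPolynomial.eval_rename, h3, hp, sub_self]

theorem mem_ghostPart_iff (i k : ZMod 2) (z : Superalgebra.ghostCenter zPart) :
    (z : Z) ∈ Superalgebra.ghostPart zPart i k ↔
      (ghostHom z : MvPolynomial (Fin 2) ℂ) ∈ PolySide.polyPart i k := by
  rcases zmod_two_cases i with rfl | rfl
  · rw [mem_polyPart_zero_iff]
    constructor
    · intro hz
      obtain ⟨p, -, hp, hs⟩ := exists_hasCharZ_of_mem hz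
      rw [ghostHom_eq hp]
      exact hs
    · exact mem_ghostPart_of_hasCharZ z.2 (hasCharZ_ghostHom z)
  -- In odd degree both sides are zero: odd ghost elements vanish, and `ghostHom` is injective.
  · have h1 : (ghostHom z : MvPolynomial (Fin 2) ℂ) ∈ PolySide.polyPart 1 k ↔ ghostHom z = 0 := by
      simp [PolySide.polyPart]
    rw [h1]
    constructor
    · intro hz
      have : z = 0 := Subtype.ext (ghostPart_odd_eq_zero hz)
      rw [this, map_zero]
    · intro hz
      rw [← map_zero ghostHom] at hz
      rw [ghostHom_injective hz]
      exact zero_mem _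

end DiagRed

theorem theorem1 :
    ∃ φ : Superalgebra.ghostCenter DiagRed.zPart ≃ₐ[ℂ] PolySide.target,
      (∃ hC : DiagRed.C1 ∈ Superalgebra.ghostCenter DiagRed.zPart,
        (φ ⟨DiagRed.C1, hC⟩ : MvPolynomial (Fin 2) ℂ)
          = 2 * MvPolynomial.X 0 * MvPolynomial.X 1) ∧
      (∃ hC : DiagRed.C2 ∈ Superalgebra.ghostCenter DiagRed.zPart,
        (φ ⟨DiagRed.C2, hC⟩ : MvPolynomial (Fin 2) ℂ)
          = MvPolynomial.X 0 ^ 2 + MvPolynomial.X 1 ^ 2) ∧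
      (∃ hQ : DiagRed.Q2 ∈ Superalgebra.ghostCenter DiagRed.zPart,
        (φ ⟨DiagRed.Q2, hQ⟩ : MvPolynomial (Fin 2) ℂ)
          = MvPolynomial.X 0 ^ 2 - MvPolynomial.X 1 ^ 2) ∧
      ∀ (i k : ZMod 2) (z : Superalgebra.ghostCenter DiagRed.zPart),
        (z : DiagRed.Z) ∈ Superalgebra.ghostPart DiagRed.zPart i k ↔
          (φ z : MvPolynomial (Fin 2) ℂ) ∈ PolySide.polyPart i k :=
  ⟨AlgEquiv.ofBijective DiagRed.ghostHom
      ⟨DiagRed.ghostHom_injective, DiagRed.ghostHom_surjective⟩,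
    ⟨DiagRed.C1_mem, DiagRed.ghostHom_eq DiagRed.hasCharZ_C1⟩,
    ⟨DiagRed.C2_mem, DiagRed.ghostHom_eq DiagRed.hasCharZ_C2⟩,
    ⟨DiagRed.Q2_mem, DiagRed.ghostHom_eq DiagRed.hasCharZ_Q2⟩,
    DiagRed.mem_ghostPart_iff⟩
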